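/- Terminology. All spaces are real. A \emph{Banach function space} over a $\sigma$-finite measure space $(\Omega,\Sigma,\mu)$ is a Banach space $X$ of ($\mu$-a.e. classes of) real measurable functions, integrable on every set of finite measure, such that (1) if $f$ is measurable, $g\in X$ and $|f|\le|g|$ a.e., then $f\in X$ and $\|f\|_X\le\|g\|_X$; (2) $\chi_A\in X$ whenever $\mu(A)<\infty$. Its (K\"othe) dual is $X'=\{g:\|g\|_{X'}:=\sup_{\|f\|_X\le 1}\int|fg|\,d\mu<\infty\}$. A space is \emph{order continuous} if $\|f_n\|\to0$ whenever $0\le f_n\downarrow 0$ a.e. in the space. $X$ is \emph{$p$-convex} if there is a constant $M$ with $\big\|(\sum_{i=1}^n|x_i|^p)^{1/p}\big\|_X\le M\big(\sum_{i=1}^n\|x_i\|_X^p\big)^{1/p}$, and \emph{$s$-concave} if there is a constant $M$ with $\big(\sum_{i=1}^n\|x_i\|_X^s\big)^{1/s}\le M\big\|(\sum_{i=1}^n|x_i|^s)^{1/s}\big\|_X$, for all finite families $x_1,\dots,x_n\in X$. A linear map $T:X\to Y$ is \emph{$p$-regular} if there is $K>0$ with $\big\|(\sum_{i=1}^n|Tx_i|^p)^{1/p}\big\|_Y\le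 K\big\|(\sum_{i=1}^n|x_i|^p)^{1/p}\big\|_X$ for all finite families $x_1,\dots,x_n\in X$. Theorem. Let $1\le s\le p<\infty$. Let $X$ be a $p$-convex order continuous Banach function space over a $\sigma$-finite measure space $(\Omega,\Sigma,\mu)$, and let $Y$ be an $s$-concave Banach function space over a $\sigma$-finite measure space $(\Omega',\Sigma',\nu)$ such that $Y'$ is order continuous. Let $T:X\to Y$ be a $p$-regular linear operator. Then there are measurable functions $f$ on $\Omega$ and $g$ on $\Omega'$ such that multiplication by $f$ defines a bounded operator $M_f:X\to L_p(\mu)$, multiplication by $g$ defines a bounded operator $M_g:L_s(\nu)\to Y$, and there is a bounded linear operator $\hat T:L_p(\mu)\to L_s(\nu)$ with $$T=M_g\circ\hat T\circ M_f .$$ -/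

import Mathlib

open MeasureTheory Filter Topology
open scoped NNReal ENNReal

universe u v

/-- A (real) Banach function space over `(Ω, Σ, μ)`, i.e. a Köthe function space: a Banach space of
(classes modulo a.e. equality of) locally integrable functions which is solid, with a monotone norm,
and contains the indicator functions of all sets of finite measure.  The norm is given as an
extended norm `fnorm` on all classes of measurable functions, equal to `∞` exactly outside the
space. -/
structure BanachFunctionSpace {Ω : Type u} [MeasurableSpace Ω] (μ : Measure Ω) where
  /-- the norm, with value `∞` outside the space -/
  fnorm : (Ω →ₘ[μ] ℝ) → ℝ≥0∞
  fnorm_eq_zero_iff : ∀ f, fnorm f = 0 ↔ f = 0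
  fnorm_smul : ∀ (c : ℝ) f, fnorm (c • f) = ‖c‖ₑ * fnorm f
  fnorm_add_le : ∀ f g, fnorm (f + g) ≤ fnorm f + fnorm g
  fnorm_mono : ∀ f g, |f| ≤ |g| → fnorm f ≤ fnorm g
  complete : ∀ F : ℕ → (Ω →ₘ[μ] ℝ), (∀ n, fnorm (F n) < ∞) →
    (∀ ε : ℝ≥0∞, 0 < ε → ∃ N, ∀ m ≥ N, ∀ n ≥ N, fnorm (F m - F n) < ε) →
    ∃ f, fnorm f < ∞ ∧ Tendsto (fun n => fnorm (F n - f)) atTop (𝓝 0)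
  integrableOn : ∀ f, fnorm f < ∞ → ∀ A, MeasurableSet A → μ A < ∞ → IntegrableOn f A μ
  indicator_lt_top : ∀ (A : Set Ω) (hA : MeasurableSet A), μ A < ∞ →
    fnorm (AEEqFun.mk (A.indicator fun _ => (1 : ℝ))
      ((measurable_const.indicator hA).aestronglyMeasurable)) < ∞

namespace BanachFunctionSpace

variable {Ω : Type u} [MeasurableSpace Ω] {μ : Measure Ω}

/-- The elements of the Banach function space: the classes of functions of finite norm. -/
def carrier (X : BanachFunctionSpace μ) : Submodule ℝ (Ω →ₘ[μ] ℝ) where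
  carrier := {f | X.fnorm f < ∞}
  zero_mem' := by
    show X.fnorm 0 < ∞
    rw [(X.fnorm_eq_zero_iff 0).2 rfl]; exact ENNReal.zero_lt_top
  add_mem' := fun {f g} hf hg => (X.fnorm_add_le f g).trans_lt (ENNReal.add_lt_top.2 ⟨hf, hg⟩)
  smul_mem' := fun c f hf => by
    show X.fnorm (c • f) < ∞
    rw [X.fnorm_smul]
    exact ENNReal.mul_lt_top enorm_lt_top hf

noncomputable instance (X : BanachFunctionSpace μ) : Norm X.carrier :=
  ⟨fun x => (X.fnorm x).toReal⟩

theorem norm_def (X : BanachFunctionSpace μ) (x : X.carrier) : ‖x‖ = (X.fnorm x).toReal := rfl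

theorem normedSpaceCore (X : BanachFunctionSpace μ) : NormedSpace.Core ℝ X.carrier where
  norm_nonneg _ := ENNReal.toReal_nonneg
  norm_smul c x := by
    rw [norm_def, norm_def, Submodule.coe_smul, X.fnorm_smul, ENNReal.toReal_mul, toReal_enorm]
  norm_triangle x y := by
    rw [norm_def, norm_def, norm_def, Submodule.coe_add, ← ENNReal.toReal_add x.2.ne y.2.ne]
    exact ENNReal.toReal_mono (ENNReal.add_lt_top.2 ⟨x.2, y.2⟩).ne (X.fnorm_add_le _ _)
  norm_eq_zero_iff x := by
    rw [norm_def, ENNReal.toReal_eq_zero_iff, or_iff_left x.2.ne, X.fnorm_eq_zero_iff]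
    exact Submodule.coe_eq_zero

noncomputable instance (X : BanachFunctionSpace μ) : NormedAddCommGroup X.carrier :=
  NormedAddCommGroup.ofCore X.normedSpaceCore

noncomputable instance (X : BanachFunctionSpace μ) : NormedSpace ℝ X.carrier :=
  NormedSpace.ofCore X.normedSpaceCore

instance (X : BanachFunctionSpace μ) : CompleteSpace X.carrier := by
  refine Metric.complete_of_cauchySeq_tendsto fun u hu => ?_
  obtain ⟨f, hf, hlim⟩ := X.complete (fun n => (u n : Ω →ₘ[μ] ℝ)) (fun n => (u n).2) (by
    intro ε hε
    obtain ⟨δ, hδ, hδε⟩ := ENNReal.lt_iff_exists_nnreal_btwn.1 hε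
    have hδ' : (0 : ℝ) < δ := by exact_mod_cast hδ
    obtain ⟨N, hN⟩ := Metric.cauchySeq_iff.1 hu δ hδ'
    refine ⟨N, fun m hm n hn => ?_⟩
    have h := hN m hm n hn
    rw [dist_eq_norm, norm_def] at h
    refine lt_trans ?_ hδε
    exact (ENNReal.toReal_lt_toReal (u m - u n).2.ne ENNReal.coe_ne_top).1 h)
  refine ⟨⟨f, hf⟩, ?_⟩
  rw [tendsto_iff_norm_sub_tendsto_zero]
  exact (ENNReal.tendsto_toReal ENNReal.zero_ne_top).comp hlim

/-- The norm of the Köthe dual `X'`, the space of all `g` with `sup ∫ |f g| dμ < ∞`, the supremum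
being taken over the unit ball of `X`; it equals `∞` exactly outside `X'`. -/
noncomputable def dualNorm (X : BanachFunctionSpace μ) (g : Ω →ₘ[μ] ℝ) : ℝ≥0∞ :=
  ⨆ (f : Ω →ₘ[μ] ℝ) (_ : X.fnorm f ≤ 1), ∫⁻ ω, ‖f ω * g ω‖ₑ ∂μ

end BanachFunctionSpace

/-- Order continuity of the function space `{f | ρ f < ∞}` with norm `ρ`: if `0 ≤ fₙ` decreases to
`0` almost everywhere in the space, then `ρ fₙ → 0`. -/
def IsOrderContinuousNorm {Ω : Type u} [MeasurableSpace Ω] {μ : Measure Ω}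
    (ρ : (Ω →ₘ[μ] ℝ) → ℝ≥0∞) : Prop :=
  ∀ F : ℕ → (Ω →ₘ[μ] ℝ), (∀ n, ρ (F n) < ∞) → (∀ n, 0 ≤ F n) → Antitone F →
    (∀ᵐ ω ∂μ, Tendsto (fun n => F n ω) atTop (𝓝 0)) → Tendsto (fun n => ρ (F n)) atTop (𝓝 0)

/-- The (class of the) function `(∑ᵢ |xᵢ|^p)^(1/p)`. -/
noncomputable def lpSum {Ω : Type u} [MeasurableSpace Ω] {μ : Measure Ω} (p : ℝ) {n : ℕ}
    (x : Fin n → (Ω →ₘ[μ] ℝ)) : Ω →ₘ[μ] ℝ :=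
  AEEqFun.mk (fun ω => (∑ i, |x i ω| ^ p) ^ (1 / p)) (by
    have h : Measurable fun ω => (∑ i, |x i ω| ^ p) ^ (1 / p) := by
      have := fun i => (x i).measurable
      fun_prop
    exact h.aestronglyMeasurable)

namespace BanachFunctionSpace

/-- `p`-convexity of a Banach function space. -/
def IsConvex {Ω : Type u} [MeasurableSpace Ω] {μ : Measure Ω} (X : BanachFunctionSpace μ)
    (p : ℝ) : Prop :=
  ∃ M : ℝ≥0, ∀ (n : ℕ) (x : Fin n → X.carrier),
    X.fnorm (lpSum p fun i => (x i : Ω →ₘ[μ] ℝ)) ≤ M * (∑ i, X.fnorm (x i) ^ p) ^ (1 / p)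

/-- `s`-concavity of a Banach function space. -/
def IsConcave {Ω : Type u} [MeasurableSpace Ω] {μ : Measure Ω} (X : BanachFunctionSpace μ)
    (s : ℝ) : Prop :=
  ∃ M : ℝ≥0, ∀ (n : ℕ) (x : Fin n → X.carrier),
    (∑ i, X.fnorm (x i) ^ s) ^ (1 / s) ≤ M * X.fnorm (lpSum s fun i => (x i : Ω →ₘ[μ] ℝ))

end BanachFunctionSpace

/-- `(p, q)`-regularity of a linear map between Banach function spaces, for finite `p`, `q`. -/
def IsPQRegular {Ω : Type u} [MeasurableSpace Ω] {μ : Measure Ω} {Ω' : Type v} [MeasurableSpace Ω']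
    {ν : Measure Ω'} {X : BanachFunctionSpace μ} {Y : BanachFunctionSpace ν} (p q : ℝ)
    (T : X.carrier →ₗ[ℝ] Y.carrier) : Prop :=
  ∃ K : ℝ≥0, 0 < K ∧ ∀ (n : ℕ) (x : Fin n → X.carrier),
    Y.fnorm (lpSum p fun i => (T (x i) : Ω' →ₘ[ν] ℝ)) ≤
      K * X.fnorm (lpSum q fun i => (x i : Ω →ₘ[μ] ℝ))

/-- `p`-regularity is `(p, p)`-regularity. -/
def IsPRegular {Ω : Type u} [MeasurableSpace Ω] {μ : Measure Ω} {Ω' : Type v} [MeasurableSpace Ω']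
    {ν : Measure Ω'} {X : BanachFunctionSpace μ} {Y : BanachFunctionSpace ν} (p : ℝ)
    (T : X.carrier →ₗ[ℝ] Y.carrier) : Prop :=
  IsPQRegular p p T

/-!
# Factorization of `p`-regular operators through multiplication operators

For a Banach function space `X` and `q ≥ 1` put `N(u) = ‖u^(1/q)‖^q` for `u ≥ 0` (`powNrm`). This
functional is homogeneous of degree one. It is subadditive up to a constant when `X` is `q`-convex
and superadditive up to a constant when `X` is `q`-concave. With `N_X` (for `q = p`) and `N_Y` (for
`q = s`), the factorization follows from the existence of weights `h` on `Ω` and `w > 0` on `Ω'`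
with `∫ a h ≤ C N_X(a)`, `N_Y(b) ≤ ∫ b w` and `∫ |T x|^s w ≤ ∫ |x|^p h + C`: take `f = h^(1/p)` and
`g = w^(-1/s)`. The additive form of the last inequality implies the homogeneous one by scaling `x`
(`lintegral_rpow_le_of_add`), and it has the advantage of being linear in `(h, w)`.

Linearity allows the use of the Hahn–Banach theorem, in the form of a solvability criterion for
systems of linear inequalities (`exists_linearMap_le`). Apart from terms with a fixed function
`e > 0`, which serve to make `ψ` below finite on `e`, the criterion asks for the inequality
`∑ N_Y(b_j) ≤ C (∑ t_x + ∑ N_X(a_i))` whenever `∑ b_j ≤ ∑ t_x |T x|^s` and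
`∑ t_x |x|^p ≤ ∑ a_i`. It follows from the concavity of `Y`, Hölder's inequality, the `p`-regularity
of `T` and the convexity of `X` (`exists_sum_powNrm_le_of_regular`). The outcome is a pair of
positive linear functionals `φ ≤ C N_X` and `ψ ≥ N_Y` in place of the integrals against `h` and `w`
(`exists_functionals`).

Such functionals are only finitely additive, and they are replaced by their countably additive
parts, the largest measures below them. A functional that lies below `ψ` and is continuous along
increasing sequences also lies below the countably additive part of `ψ`
(`exists_density_between`). On the side of `X` this applies to `φ` itself, which is continuous
because `X` is order continuous, so that `φ` is an integral. On the side of `Y` it applies to `N_Y`: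
a concave space has the Fatou property (`IsConcave.nrm_iSup_le`). The inequality
`ψ (|T x|^s) ≤ φ (|x|^p) + C` survives since its left-hand side only gets smaller.

Finally `f x ↦ g⁻¹ T x` is bounded from a subspace of `L_p` to `L_s`. Functions of the form
`f x + k`, with `k` supported on the zero set of `f`, are dense in `L_p`, and the map extends to
`L_p` by continuity after setting it to be zero on the functions `k` (`exists_factor_through_mul`).
-/

universe w

/-! ### The norm of a Banach function space on nonnegative functions -/

namespace BanachFunctionSpace

section Nrm

variable {Ω : Type u} [MeasurableSpace Ω] {μ : Measure Ω} (X : BanachFunctionSpace μ)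

/-- The norm of `X` on arbitrary functions with values in `[0, ∞]`: the infimum of the norms of
the elements of `X` that dominate `u` almost everywhere. -/
noncomputable def nrm (u : Ω → ℝ≥0∞) : ℝ≥0∞ :=
  ⨅ (f : Ω →ₘ[μ] ℝ) (_ : ∀ᵐ ω ∂μ, u ω ≤ ‖f ω‖ₑ), X.fnorm f

theorem nrm_le_fnorm {u : Ω → ℝ≥0∞} {f : Ω →ₘ[μ] ℝ} (h : ∀ᵐ ω ∂μ, u ω ≤ ‖f ω‖ₑ) :
    X.nrm u ≤ X.fnorm f :=
  iInf₂_le f h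

theorem nrm_mono {u v : Ω → ℝ≥0∞} (h : ∀ᵐ ω ∂μ, u ω ≤ v ω) : X.nrm u ≤ X.nrm v :=
  le_iInf₂ fun f hf => X.nrm_le_fnorm (by filter_upwards [h, hf] with ω h1 h2 using h1.trans h2)

theorem nrm_congr {u v : Ω → ℝ≥0∞} (h : u =ᵐ[μ] v) : X.nrm u = X.nrm v :=
  le_antisymm (X.nrm_mono h.le) (X.nrm_mono h.symm.le)

theorem fnorm_le_of_enorm_le {f g : Ω →ₘ[μ] ℝ} (h : ∀ᵐ ω ∂μ, ‖f ω‖ₑ ≤ ‖g ω‖ₑ) :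
    X.fnorm f ≤ X.fnorm g := by
  refine X.fnorm_mono _ _ ?_
  rw [← AEEqFun.coeFn_le]
  filter_upwards [h, AEEqFun.coeFn_abs f, AEEqFun.coeFn_abs g] with ω h1 h2 h3
  rw [h2, h3]
  simpa only [enorm_le_iff_norm_le, Real.norm_eq_abs] using h1

theorem nrm_enorm (f : Ω →ₘ[μ] ℝ) : X.nrm (fun ω => ‖f ω‖ₑ) = X.fnorm f :=
  le_antisymm (X.nrm_le_fnorm (Eventually.of_forall fun _ => le_rfl))
    (le_iInf₂ fun _ hg => X.fnorm_le_of_enorm_le hg)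

theorem exists_fnorm_lt {u : Ω → ℝ≥0∞} {c : ℝ≥0∞} (h : X.nrm u < c) :
    ∃ f : Ω →ₘ[μ] ℝ, (∀ᵐ ω ∂μ, u ω ≤ ‖f ω‖ₑ) ∧ X.fnorm f < c := by
  simpa only [nrm, iInf_lt_iff, exists_prop] using h

theorem ae_lt_top_of_nrm_lt_top {u : Ω → ℝ≥0∞} (h : X.nrm u < ∞) : ∀ᵐ ω ∂μ, u ω < ∞ := by
  obtain ⟨f, hf, -⟩ := X.exists_fnorm_lt h
  filter_upwards [hf] with ω hω using hω.trans_lt enorm_lt_top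

theorem exists_carrier_enorm_eq {u : Ω → ℝ≥0∞} (hu : Measurable u) (h : X.nrm u < ∞) :
    ∃ f : X.carrier, ((f : Ω →ₘ[μ] ℝ) : Ω → ℝ) =ᵐ[μ] (fun ω => (u ω).toReal) ∧
      ∀ᵐ ω ∂μ, ‖(f : Ω →ₘ[μ] ℝ) ω‖ₑ = u ω := by
  let f : Ω →ₘ[μ] ℝ := AEEqFun.mk (fun ω => (u ω).toReal) hu.ennreal_toReal.aestronglyMeasurable
  have h0 : (f : Ω → ℝ) =ᵐ[μ] (fun ω => (u ω).toReal) := AEEqFun.coeFn_mk _ _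
  have h1 : ∀ᵐ ω ∂μ, ‖f ω‖ₑ = u ω := by
    filter_upwards [h0, X.ae_lt_top_of_nrm_lt_top h] with ω h2 h3
    rw [h2, Real.enorm_eq_ofReal ENNReal.toReal_nonneg, ENNReal.ofReal_toReal h3.ne]
  refine ⟨⟨f, ?_⟩, h0, h1⟩
  show X.fnorm f < ∞
  rwa [← X.nrm_enorm f, X.nrm_congr h1]

theorem nrm_zero : X.nrm (fun _ => 0) = 0 :=
  le_antisymm ((X.nrm_le_fnorm (f := 0) (by simp)).trans ((X.fnorm_eq_zero_iff 0).2 rfl).le) bot_le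

theorem nrm_add_le (u v : Ω → ℝ≥0∞) : X.nrm (fun ω => u ω + v ω) ≤ X.nrm u + X.nrm v := by
  refine ENNReal.le_of_forall_pos_le_add fun ε hε hlt => ?_
  have hε2 : (0 : ℝ≥0∞) < ε / 2 := ENNReal.half_pos (by exact_mod_cast hε.ne')
  obtain ⟨hu, hv⟩ := ENNReal.add_lt_top.1 hlt
  obtain ⟨f, hf, hf'⟩ := X.exists_fnorm_lt (ENNReal.lt_add_right hu.ne hε2.ne')
  obtain ⟨g, hg, hg'⟩ := X.exists_fnorm_lt (ENNReal.lt_add_right hv.ne hε2.ne')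
  have key : X.nrm (fun ω => u ω + v ω) ≤ X.fnorm (|f| + |g|) := by
    refine X.nrm_le_fnorm ?_
    filter_upwards [hf, hg, AEEqFun.coeFn_abs f, AEEqFun.coeFn_abs g,
      AEEqFun.coeFn_add |f| |g|] with ω h1 h2 h3 h4 h5
    rw [h5, Pi.add_apply, h3, h4, Real.enorm_eq_ofReal (by positivity),
      ENNReal.ofReal_add (by positivity) (by positivity), ← Real.enorm_eq_ofReal_abs,
      ← Real.enorm_eq_ofReal_abs]
    exact add_le_add h1 h2
  have habs : ∀ f : Ω →ₘ[μ] ℝ, X.fnorm |f| ≤ X.fnorm f := fun f =>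
    X.fnorm_le_of_enorm_le (by
      filter_upwards [AEEqFun.coeFn_abs f] with ω h
      rw [h, Real.enorm_abs])
  calc X.nrm (fun ω => u ω + v ω) ≤ X.fnorm |f| + X.fnorm |g| := key.trans (X.fnorm_add_le _ _)
    _ ≤ (X.nrm u + ε / 2) + (X.nrm v + ε / 2) :=
        add_le_add ((habs f).trans hf'.le) ((habs g).trans hg'.le)
    _ = X.nrm u + X.nrm v + ε := by rw [add_add_add_comm, ENNReal.add_halves]

theorem nrm_smul (c : ℝ≥0) (u : Ω → ℝ≥0∞) : X.nrm (fun ω => c * u ω) = c * X.nrm u := by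
  have key : ∀ (c : ℝ≥0) (u : Ω → ℝ≥0∞), c ≠ 0 → X.nrm (fun ω => c * u ω) ≤ c * X.nrm u := by
    intro c u hc
    rw [nrm, nrm, ENNReal.mul_iInf_of_ne (by exact_mod_cast hc) ENNReal.coe_ne_top]
    refine le_iInf fun f => ?_
    rw [ENNReal.mul_iInf_of_ne (by exact_mod_cast hc) ENNReal.coe_ne_top]
    refine le_iInf fun hf => iInf₂_le_of_le ((c : ℝ) • f) ?_ ?_
    · filter_upwards [hf, AEEqFun.coeFn_smul (c : ℝ) f] with ω h1 h2
      rw [h2, Pi.smul_apply, enorm_smul]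
      simpa [enorm_eq_nnnorm] using mul_le_mul_right h1 _
    · rw [X.fnorm_smul]; simp [enorm_eq_nnnorm]
  rcases eq_or_ne c 0 with rfl | hc
  · simp [X.nrm_zero]
  refine le_antisymm (key c u hc) ?_
  have := key c⁻¹ (fun ω => c * u ω) (inv_ne_zero hc)
  have h1 : ∀ x : ℝ≥0∞, ((c⁻¹ : ℝ≥0) : ℝ≥0∞) * (c * x) = x := fun x => by
    rw [← mul_assoc, ← ENNReal.coe_mul, inv_mul_cancel₀ hc, ENNReal.coe_one, one_mul]
  simp only [h1] at this
  calc c * X.nrm u ≤ c * (((c⁻¹ : ℝ≥0) : ℝ≥0∞) * X.nrm (fun ω => c * u ω)) := mul_le_mul_right this _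
    _ = _ := by rw [← mul_assoc, ← ENNReal.coe_mul, mul_inv_cancel₀ hc, ENNReal.coe_one, one_mul]

theorem ae_eq_zero_of_nrm_eq_zero {u : Ω → ℝ≥0∞} (hu : Measurable u) (h : X.nrm u = 0) :
    ∀ᵐ ω ∂μ, u ω = 0 := by
  obtain ⟨f, -, hf⟩ := X.exists_carrier_enorm_eq hu (h ▸ ENNReal.zero_lt_top)
  have h1 : X.fnorm f = 0 := by rw [← X.nrm_enorm, X.nrm_congr hf, h]
  have h2 := (X.fnorm_eq_zero_iff _).1 h1
  filter_upwards [hf, h2 ▸ AEEqFun.coeFn_zero (α := Ω) (β := ℝ) (μ := μ)] with ω h3 h4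
  rw [← h3, h4]; simp

theorem fnorm_eq_enorm (x : X.carrier) : X.fnorm x = ‖x‖ₑ := by
  rw [← ofReal_norm, norm_def, ENNReal.ofReal_toReal x.2.ne]

/-- The norm is continuous along increasing sequences that are Cauchy: the limit of the sequence
in `X` dominates all its terms. -/
theorem nrm_iSup_le_of_cauchySeq {u : ℕ → Ω → ℝ≥0∞} (hmono : ∀ ω, Monotone fun n => u n ω)
    {f : ℕ → X.carrier} (hf : ∀ n, ((f n : Ω →ₘ[μ] ℝ) : Ω → ℝ) =ᵐ[μ] fun ω => (u n ω).toReal)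
    (hu : ∀ n, ∀ᵐ ω ∂μ, u n ω < ∞)
    (hc : CauchySeq f) : X.nrm (fun ω => ⨆ n, u n ω) ≤ ⨆ n, X.nrm (u n) := by
  obtain ⟨z, hz⟩ := cauchySeq_tendsto_of_complete hc
  have hfe : ∀ n, ∀ᵐ ω ∂μ, ‖(f n : Ω →ₘ[μ] ℝ) ω‖ₑ = u n ω := fun n => by
    filter_upwards [hf n, hu n] with ω h1 h2
    rw [h1, Real.enorm_eq_ofReal ENNReal.toReal_nonneg, ENNReal.ofReal_toReal h2.ne]
  have hle : ∀ n, ∀ᵐ ω ∂μ, u n ω ≤ ‖(z : Ω →ₘ[μ] ℝ) ω‖ₑ := by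
    intro n
    -- the part of `u n` above `z` is dominated by `|u m - z|` for all `m ≥ n`
    have h0 : X.nrm (fun ω => ENNReal.ofReal ((u n ω).toReal - (z : Ω →ₘ[μ] ℝ) ω)) = 0 := by
      refine le_antisymm (ge_of_tendsto (f := fun m => ‖f m - z‖ₑ) (x := atTop) ?_ ?_) bot_le
      · have := (tendsto_iff_norm_sub_tendsto_zero.1 hz)
        have h2 := ENNReal.tendsto_ofReal this
        simpa only [ofReal_norm, ENNReal.ofReal_zero] using h2
      · filter_upwards [eventually_ge_atTop n] with m hm
        rw [← X.fnorm_eq_enorm]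
        refine X.nrm_le_fnorm ?_
        filter_upwards [hf m, hu m,
          AEEqFun.coeFn_sub (f m : Ω →ₘ[μ] ℝ) (z : Ω →ₘ[μ] ℝ)] with ω h1 h2 h3
        rw [Submodule.coe_sub, h3, Pi.sub_apply, h1, Real.enorm_eq_ofReal_abs]
        refine ENNReal.ofReal_le_ofReal ((sub_le_sub_right ?_ _).trans (le_abs_self _))
        exact ENNReal.toReal_mono h2.ne (hmono ω hm)
    have h3 : X.nrm (fun ω => ENNReal.ofReal ((f n : Ω →ₘ[μ] ℝ) ω - (z : Ω →ₘ[μ] ℝ) ω)) = 0 := by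
      rw [← h0]; refine X.nrm_congr ?_
      filter_upwards [hf n] with ω h; rw [h]
    have h4 := X.ae_eq_zero_of_nrm_eq_zero
      (((f n : Ω →ₘ[μ] ℝ).measurable.sub (z : Ω →ₘ[μ] ℝ).measurable).ennreal_ofReal) h3
    filter_upwards [h4, hfe n, hf n] with ω h5 h6 h7
    rw [ENNReal.ofReal_eq_zero, Pi.sub_apply, sub_nonpos] at h5
    rw [← h6, enorm_le_iff_norm_le, Real.norm_eq_abs, Real.norm_eq_abs,
      abs_of_nonneg (h7 ▸ ENNReal.toReal_nonneg)]
    exact h5.trans (le_abs_self _)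
  calc X.nrm (fun ω => ⨆ n, u n ω) ≤ X.fnorm z :=
        X.nrm_le_fnorm (by filter_upwards [ae_all_iff.2 hle] with ω h using iSup_le h)
    _ ≤ ⨆ n, X.nrm (u n) := by
        rw [X.fnorm_eq_enorm]
        refine le_of_tendsto hz.enorm (Eventually.of_forall fun n => ?_)
        rw [← X.fnorm_eq_enorm, ← X.nrm_enorm, X.nrm_congr (hfe n)]
        exact le_iSup (fun n => X.nrm (u n)) n

theorem enorm_sub_eq_nrm {u v : Ω → ℝ≥0∞} {f g : X.carrier}
    (hf : ((f : Ω →ₘ[μ] ℝ) : Ω → ℝ) =ᵐ[μ] fun ω => (u ω).toReal)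
    (hg : ((g : Ω →ₘ[μ] ℝ) : Ω → ℝ) =ᵐ[μ] fun ω => (v ω).toReal)
    (hu : ∀ᵐ ω ∂μ, u ω < ∞) (h : ∀ᵐ ω ∂μ, v ω ≤ u ω) :
    ‖f - g‖ₑ = X.nrm (fun ω => u ω - v ω) := by
  rw [← X.fnorm_eq_enorm, ← X.nrm_enorm]
  refine X.nrm_congr ?_
  filter_upwards [hf, hg, hu, h, AEEqFun.coeFn_sub (f : Ω →ₘ[μ] ℝ) (g : Ω →ₘ[μ] ℝ)]
    with ω h1 h2 h3 h4 h5
  rw [Submodule.coe_sub, h5, Pi.sub_apply, h1, h2, ← ENNReal.toReal_sub_of_le h4 h3.ne,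
    Real.enorm_eq_ofReal ENNReal.toReal_nonneg,
    ENNReal.ofReal_toReal (tsub_le_self.trans_lt h3).ne]

/-- A series of nonnegative functions whose norms are summable has a sum of finite norm; this is
where completeness of `X` enters. -/
theorem nrm_tsum_lt_top {u : ℕ → Ω → ℝ≥0∞} (hu : ∀ n, Measurable (u n))
    (h : ∑' n, X.nrm (u n) ≠ ∞) : X.nrm (fun ω => ∑' n, u n ω) < ∞ := by
  let S : ℕ → Ω → ℝ≥0∞ := fun n ω => ∑ k ∈ Finset.range n, u k ω
  have hS : ∀ n, Measurable (S n) := fun n => Finset.measurable_fun_sum _ fun k _ => hu k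
  have hle : ∀ n, X.nrm (S n) ≤ ∑' n, X.nrm (u n) := by
    intro n
    refine le_trans ?_ (ENNReal.sum_le_tsum (Finset.range n))
    induction n with
    | zero => simp [S, X.nrm_zero]
    | succ n ih =>
      simp only [S, Finset.sum_range_succ]
      exact (X.nrm_add_le _ _).trans (add_le_add ih le_rfl)
  have hlt : ∀ n, X.nrm (S n) < ∞ := fun n => (hle n).trans_lt h.lt_top
  choose f hf hf' using fun n => X.exists_carrier_enorm_eq (hS n) (hlt n)
  have hfin : ∀ n, ∀ᵐ ω ∂μ, S n ω < ∞ := fun n => X.ae_lt_top_of_nrm_lt_top (hlt n)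
  have hmono : ∀ ω, Monotone fun n => S n ω := fun ω =>
    Finset.sum_mono_set_of_nonneg (fun _ => bot_le) |>.comp Finset.range_mono
  have hc : CauchySeq f := by
    refine cauchySeq_of_edist_le_of_tsum_ne_top (fun n => X.nrm (u n)) (fun n => ?_) h
    rw [edist_comm, edist_eq_enorm_sub, X.enorm_sub_eq_nrm (hf (n + 1)) (hf n) (hfin (n + 1))
      (Eventually.of_forall fun ω => hmono ω n.le_succ)]
    refine X.nrm_mono ?_
    filter_upwards [hfin n] with ω hω
    simp only [S, Finset.sum_range_succ] at hω ⊢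
    rw [ENNReal.add_sub_cancel_left hω.ne]
  have := X.nrm_iSup_le_of_cauchySeq hmono hf hfin hc
  simp only [ENNReal.tsum_eq_iSup_nat]
  exact (this.trans (iSup_le hle)).trans_lt h.lt_top

/-- A Banach function space over a `σ`-finite measure space contains a strictly positive
function. -/
theorem exists_pos_nrm_lt_top [SigmaFinite μ] :
    ∃ e : Ω → ℝ≥0, Measurable e ∧ (∀ ω, 0 < e ω) ∧ X.nrm (fun ω => e ω) < ∞ := by
  let A := spanningSets μ
  have hA : ∀ n, MeasurableSet (A n) := measurableSet_spanningSets μ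
  let χ : ℕ → Ω → ℝ≥0∞ := fun n => (A n).indicator 1
  have hχ : ∀ n, Measurable (χ n) := fun n => measurable_one.indicator (hA n)
  have hfin : ∀ n, X.nrm (χ n) < ∞ := by
    intro n
    refine lt_of_le_of_lt ?_ (X.indicator_lt_top (A n) (hA n) (measure_spanningSets_lt_top μ n))
    refine X.nrm_le_fnorm ?_
    filter_upwards [AEEqFun.coeFn_mk (μ := μ) ((A n).indicator fun _ => (1 : ℝ))
      ((measurable_const.indicator (hA n)).aestronglyMeasurable)] with ω h
    rw [h]
    by_cases hω : ω ∈ A n <;> simp [χ, hω]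
  obtain ⟨c, hc, hcs⟩ := ENNReal.exists_pos_tsum_mul_lt_of_countable (ε := 1) one_ne_zero
    (fun n => 1 + X.nrm (χ n)) (fun n => (ENNReal.add_lt_top.2 ⟨ENNReal.one_lt_top, hfin n⟩).ne)
  have hcs1 : ∑' n, (c n : ℝ≥0∞) < ∞ := by
    refine lt_of_le_of_lt (ENNReal.tsum_le_tsum fun n => ?_) (hcs.trans ENNReal.one_lt_top)
    rw [mul_comm]
    exact le_mul_of_one_le_right bot_le le_self_add
  have hcs2 : ∑' n, X.nrm (fun ω => c n * χ n ω) < ∞ := by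
    refine lt_of_le_of_lt (ENNReal.tsum_le_tsum fun n => ?_) (hcs.trans ENNReal.one_lt_top)
    rw [X.nrm_smul, mul_comm]
    exact mul_le_mul_left le_add_self _
  have hm : ∀ n, Measurable fun ω => c n * χ n ω := fun n => (hχ n).const_mul _
  have he : ∀ ω, ∑' n, c n * χ n ω < ∞ := fun ω => by
    refine lt_of_le_of_lt (ENNReal.tsum_le_tsum fun n => ?_) hcs1
    by_cases hω : ω ∈ A n <;> simp [χ, hω]
  refine ⟨fun ω => (∑' n, c n * χ n ω).toNNReal, (Measurable.tsum hm).ennreal_toNNReal,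
    fun ω => ?_, ?_⟩
  · refine ENNReal.toNNReal_pos ?_ (he ω).ne
    have : ω ∈ ⋃ n, A n := by rw [iUnion_spanningSets]; trivial
    obtain ⟨n, hn⟩ := Set.mem_iUnion.1 this
    intro h0
    have := ENNReal.tsum_eq_zero.1 h0 n
    simp [χ, hn, (hc n).ne'] at this
  · simp only [ENNReal.coe_toNNReal (he _).ne]
    exact X.nrm_tsum_lt_top hm hcs2.ne

end Nrm
end BanachFunctionSpace

/-! ### Convexity, concavity, order continuity and regularity for powers -/

namespace BanachFunctionSpace

section PowNrm

variable {Ω : Type u} [MeasurableSpace Ω] {μ : Measure Ω} (X : BanachFunctionSpace μ)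

/-- The functional `u ↦ ‖u^(1/q)‖^q` on nonnegative functions. It is homogeneous of degree one, and
it is subadditive or superadditive, up to a constant, when `X` is `q`-convex or `q`-concave. -/
noncomputable def powNrm (q : ℝ) (u : Ω → ℝ≥0∞) : ℝ≥0∞ :=
  X.nrm (fun ω => u ω ^ (1 / q)) ^ q

theorem powNrm_mono {q : ℝ} (hq : 0 < q) {u v : Ω → ℝ≥0∞} (h : ∀ᵐ ω ∂μ, u ω ≤ v ω) :
    X.powNrm q u ≤ X.powNrm q v :=
  ENNReal.rpow_le_rpow (X.nrm_mono (by
    filter_upwards [h] with ω hω using ENNReal.rpow_le_rpow hω (by positivity))) hq.le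

theorem powNrm_congr {q : ℝ} (hq : 0 < q) {u v : Ω → ℝ≥0∞} (h : u =ᵐ[μ] v) :
    X.powNrm q u = X.powNrm q v :=
  le_antisymm (X.powNrm_mono hq h.le) (X.powNrm_mono hq h.symm.le)

theorem powNrm_zero {q : ℝ} (hq : 0 < q) : X.powNrm q (fun _ => 0) = 0 := by
  have : (0 : ℝ) < 1 / q := by positivity
  simp [powNrm, ENNReal.zero_rpow_of_pos this, X.nrm_zero, ENNReal.zero_rpow_of_pos hq,
    -one_div]

theorem powNrm_rpow {q : ℝ} (hq : 0 < q) (u : Ω → ℝ≥0∞) :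
    X.powNrm q (fun ω => u ω ^ q) = X.nrm u ^ q := by
  simp only [powNrm, ← ENNReal.rpow_mul, mul_one_div_cancel hq.ne', ENNReal.rpow_one]

theorem powNrm_lt_top_iff {q : ℝ} (hq : 0 < q) {u : Ω → ℝ≥0∞} :
    X.powNrm q u < ∞ ↔ X.nrm (fun ω => u ω ^ (1 / q)) < ∞ :=
  ENNReal.rpow_lt_top_iff_of_pos hq

theorem powNrm_smul {q : ℝ} (hq : 0 < q) (c : ℝ≥0) (u : Ω → ℝ≥0∞) :
    X.powNrm q (fun ω => c * u ω) = c * X.powNrm q u := by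
  have h : (0 : ℝ) ≤ 1 / q := by positivity
  have h1 : ∀ ω, (c * u ω) ^ (1 / q) = ((c ^ (1 / q) : ℝ≥0) : ℝ≥0∞) * u ω ^ (1 / q) := fun ω => by
    rw [ENNReal.mul_rpow_of_nonneg _ _ h, ENNReal.coe_rpow_of_nonneg _ h]
  simp only [powNrm, h1, X.nrm_smul]
  rw [ENNReal.mul_rpow_of_nonneg _ _ hq.le, ENNReal.coe_rpow_of_nonneg _ h, ← ENNReal.rpow_mul,
    one_div_mul_cancel hq.ne', ENNReal.rpow_one]

theorem powNrm_add_le {q : ℝ} (hq : 1 ≤ q) (u v : Ω → ℝ≥0∞) :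
    X.powNrm q (fun ω => u ω + v ω) ≤ 2 ^ (q - 1) * (X.powNrm q u + X.powNrm q v) := by
  have hq0 : 0 < q := by linarith
  refine le_trans ?_ (ENNReal.rpow_add_le_mul_rpow_add_rpow _ _ hq)
  refine ENNReal.rpow_le_rpow (le_trans (X.nrm_mono (Eventually.of_forall fun ω => ?_))
    (X.nrm_add_le _ _)) hq0.le
  exact ENNReal.rpow_add_le_add_rpow _ _ (by positivity) (by rw [div_le_one hq0]; exact hq)

theorem ae_eq_zero_of_powNrm_eq_zero {q : ℝ} (hq : 0 < q) {u : Ω → ℝ≥0∞} (hu : Measurable u)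
    (h : X.powNrm q u = 0) : ∀ᵐ ω ∂μ, u ω = 0 := by
  have h1 := X.ae_eq_zero_of_nrm_eq_zero (hu.pow_const _)
    ((ENNReal.rpow_eq_zero_iff_of_pos hq).1 h)
  filter_upwards [h1] with ω hω
  exact (ENNReal.rpow_eq_zero_iff_of_pos (by positivity)).1 hω

theorem exists_carrier_enorm_rpow_eq {q : ℝ} (hq : 0 < q) {u : Ω → ℝ≥0∞} (hu : Measurable u)
    (h : X.powNrm q u < ∞) :
    ∃ f : X.carrier, ∀ᵐ ω ∂μ, ‖(f : Ω →ₘ[μ] ℝ) ω‖ₑ ^ q = u ω := by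
  obtain ⟨f, -, hf⟩ := X.exists_carrier_enorm_eq (hu.pow_const (1 / q))
    ((X.powNrm_lt_top_iff hq).1 h)
  refine ⟨f, ?_⟩
  filter_upwards [hf] with ω hω
  rw [hω, ← ENNReal.rpow_mul, one_div_mul_cancel hq.ne', ENNReal.rpow_one]

theorem powNrm_enorm_rpow {q : ℝ} (hq : 0 < q) (f : Ω →ₘ[μ] ℝ) :
    X.powNrm q (fun ω => ‖f ω‖ₑ ^ q) = X.fnorm f ^ q := by
  rw [X.powNrm_rpow hq, X.nrm_enorm]

theorem fnorm_lpSum_rpow {q : ℝ} (hq : 0 < q) {n : ℕ} (x : Fin n → (Ω →ₘ[μ] ℝ)) :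
    X.fnorm (lpSum q x) ^ q = X.powNrm q (fun ω => ∑ i, ‖x i ω‖ₑ ^ q) := by
  rw [← X.nrm_enorm, powNrm]
  congr 1
  refine X.nrm_congr ?_
  have h : ((lpSum q x : Ω →ₘ[μ] ℝ) : Ω → ℝ) =ᵐ[μ] fun ω => (∑ i, |x i ω| ^ q) ^ (1 / q) :=
    AEEqFun.coeFn_mk _ _
  filter_upwards [h] with ω hω
  rw [hω, Real.enorm_eq_ofReal (by positivity),
    ← ENNReal.ofReal_rpow_of_nonneg (by positivity) (by positivity),
    ENNReal.ofReal_sum_of_nonneg (fun i _ => by positivity)]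
  congr 1
  refine Finset.sum_congr rfl fun i _ => ?_
  rw [Real.enorm_eq_ofReal_abs, ENNReal.ofReal_rpow_of_nonneg (abs_nonneg _) hq.le]

end PowNrm

theorem sum_equivFin {ι M : Type*} [AddCommMonoid M] (S : Finset ι) (g : ι → M) :
    ∑ j, g (S.equivFin.symm j) = ∑ i ∈ S, g i := by
  rw [← Finset.sum_coe_sort S g]
  exact S.equivFin.symm.sum_comp (fun i : S => g i)

section Convexity

variable {Ω : Type u} [MeasurableSpace Ω] {μ : Measure Ω} {X : BanachFunctionSpace μ}

theorem IsConvex.exists_powNrm_sum_le {q : ℝ} (hq : 0 < q) (hX : X.IsConvex q) :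
    ∃ M : ℝ≥0, ∀ {ι : Type w} (S : Finset ι) (a : ι → Ω → ℝ≥0∞),
      (∀ i, Measurable (a i)) → (∀ i, X.powNrm q (a i) < ∞) →
        X.powNrm q (fun ω => ∑ i ∈ S, a i ω) ≤ M * ∑ i ∈ S, X.powNrm q (a i) := by
  obtain ⟨M, hM⟩ := hX
  refine ⟨M ^ q, fun S a ha hfin => ?_⟩
  choose f hf using fun i => X.exists_carrier_enorm_rpow_eq hq (ha i) (hfin i)
  have h := ENNReal.rpow_le_rpow (hM S.card fun j => f (S.equivFin.symm j)) hq.le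
  rw [X.fnorm_lpSum_rpow hq, ENNReal.mul_rpow_of_nonneg _ _ hq.le, ← ENNReal.rpow_mul,
    one_div_mul_cancel hq.ne', ENNReal.rpow_one, sum_equivFin S fun i => X.fnorm (f i) ^ q] at h
  rw [ENNReal.coe_rpow_of_nonneg _ hq.le]
  refine le_trans (le_of_eq ?_) (h.trans (le_of_eq ?_))
  · refine X.powNrm_congr hq ?_
    filter_upwards [(ae_ball_iff S.countable_toSet).2 fun i _ => hf i] with ω hω
    rw [sum_equivFin S fun i => ‖(f i : Ω →ₘ[μ] ℝ) ω‖ₑ ^ q]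
    exact Finset.sum_congr rfl fun i hi => (hω i hi).symm
  · congr 1
    refine Finset.sum_congr rfl fun i _ => ?_
    rw [← X.powNrm_enorm_rpow hq, X.powNrm_congr hq (hf i)]

theorem IsConcave.exists_sum_powNrm_le {q : ℝ} (hq : 0 < q) (hX : X.IsConcave q) :
    ∃ M : ℝ≥0, ∀ {ι : Type w} (S : Finset ι) (a : ι → Ω → ℝ≥0∞),
      (∀ i, Measurable (a i)) → (∀ i, X.powNrm q (a i) < ∞) →
        ∑ i ∈ S, X.powNrm q (a i) ≤ M * X.powNrm q (fun ω => ∑ i ∈ S, a i ω) := by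
  obtain ⟨M, hM⟩ := hX
  refine ⟨M ^ q, fun S a ha hfin => ?_⟩
  choose f hf using fun i => X.exists_carrier_enorm_rpow_eq hq (ha i) (hfin i)
  have h := ENNReal.rpow_le_rpow (hM S.card fun j => f (S.equivFin.symm j)) hq.le
  rw [ENNReal.mul_rpow_of_nonneg _ _ hq.le, X.fnorm_lpSum_rpow hq, ← ENNReal.rpow_mul,
    one_div_mul_cancel hq.ne', ENNReal.rpow_one, sum_equivFin S fun i => X.fnorm (f i) ^ q] at h
  rw [ENNReal.coe_rpow_of_nonneg _ hq.le]
  refine le_trans (le_of_eq ?_) (h.trans (le_of_eq ?_))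
  · refine Finset.sum_congr rfl fun i _ => ?_
    rw [← X.powNrm_enorm_rpow hq, X.powNrm_congr hq (hf i)]
  · congr 1
    refine X.powNrm_congr hq ?_
    filter_upwards [(ae_ball_iff S.countable_toSet).2 fun i _ => hf i] with ω hω
    rw [sum_equivFin S fun i => ‖(f i : Ω →ₘ[μ] ℝ) ω‖ₑ ^ q]
    exact Finset.sum_congr rfl fun i hi => (hω i hi)

/-- A concave Banach function space has the Fatou property: an increasing sequence with bounded
norms is Cauchy, since `q`-concavity bounds the number of increments of norm at least `ε`. -/
theorem IsConcave.nrm_iSup_le {q : ℝ} (hq : 1 ≤ q) (hX : X.IsConcave q) {u : ℕ → Ω → ℝ≥0∞}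
    (hu : ∀ n, Measurable (u n)) (hmono : ∀ ω, Monotone fun n => u n ω) :
    X.nrm (fun ω => ⨆ n, u n ω) ≤ ⨆ n, X.nrm (u n) := by
  have hq0 : 0 < q := by linarith
  rcases eq_or_ne (⨆ n, X.nrm (u n)) ∞ with htop | htop
  · rw [htop]; exact le_top
  have hlt : ∀ n, X.nrm (u n) < ∞ := fun n =>
    (le_iSup (fun n => X.nrm (u n)) n).trans_lt htop.lt_top
  choose f hf hf' using fun n => X.exists_carrier_enorm_eq (hu n) (hlt n)
  have hfin : ∀ n, ∀ᵐ ω ∂μ, u n ω < ∞ := fun n => X.ae_lt_top_of_nrm_lt_top (hlt n)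
  refine X.nrm_iSup_le_of_cauchySeq hmono hf hfin ?_
  by_contra hcau
  rw [EMetric.cauchySeq_iff'] at hcau
  push Not at hcau
  obtain ⟨ε, hε, hcau⟩ := hcau
  choose k hk hkε using hcau
  -- `N j` is a sequence of indices along which all increments have norm at least `ε`
  let N : ℕ → ℕ := fun j => k^[j] 0
  have hN : ∀ j, N (j + 1) = k (N j) := fun j => Function.iterate_succ_apply' k j 0
  have hNle : ∀ j, N j ≤ N (j + 1) := fun j => by rw [hN]; exact hk _
  let a : ℕ → Ω → ℝ≥0∞ := fun j ω => (u (N (j + 1)) ω - u (N j) ω) ^ q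
  have ham : ∀ j, Measurable (a j) := fun j => ((hu _).sub (hu _)).pow_const _
  have haN : ∀ j, X.powNrm q (a j) = X.nrm (fun ω => u (N (j + 1)) ω - u (N j) ω) ^ q := fun j =>
    X.powNrm_rpow hq0 _
  have hafin : ∀ j, X.powNrm q (a j) < ∞ := fun j => by
    rw [haN, ENNReal.rpow_lt_top_iff_of_pos hq0]
    exact (X.nrm_mono (Eventually.of_forall fun ω => tsub_le_self)).trans_lt (hlt (N (j + 1)))
  have haε : ∀ j, ε ^ q ≤ X.powNrm q (a j) := fun j => by
    rw [haN]
    refine ENNReal.rpow_le_rpow ?_ hq0.le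
    rw [← X.enorm_sub_eq_nrm (hf _) (hf _) (hfin _)
      (Eventually.of_forall fun ω => hmono ω (hNle j)), ← edist_eq_enorm_sub, hN]
    exact hkε _
  have hasum : ∀ (J : ℕ) ω, ∑ j ∈ Finset.range J, a j ω ≤ u (N J) ω ^ q := by
    intro J ω
    induction J with
    | zero => simp
    | succ J ih =>
      rw [Finset.sum_range_succ]
      refine (add_le_add ih le_rfl).trans ((ENNReal.add_rpow_le_rpow_add _ _ hq).trans ?_)
      rw [add_tsub_cancel_of_le (hmono ω (hNle J))]
  obtain ⟨M, hM⟩ := IsConcave.exists_sum_powNrm_le.{u, 0} hq0 hX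
  have hbound : ∀ J : ℕ, J * ε ^ q ≤ M * (⨆ n, X.nrm (u n)) ^ q := by
    intro J
    calc J * ε ^ q = ∑ j ∈ Finset.range J, ε ^ q := by simp
      _ ≤ ∑ j ∈ Finset.range J, X.powNrm q (a j) := Finset.sum_le_sum fun j _ => haε j
      _ ≤ M * X.powNrm q (fun ω => ∑ j ∈ Finset.range J, a j ω) := hM _ a ham hafin
      _ ≤ M * X.powNrm q (fun ω => u (N J) ω ^ q) := by
          gcongr; exact X.powNrm_mono hq0 (Eventually.of_forall (hasum J))
      _ ≤ _ := by
          rw [X.powNrm_rpow hq0]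
          gcongr; exact le_iSup (fun n => X.nrm (u n)) (N J)
  obtain ⟨J, hJ⟩ := ENNReal.exists_nat_mul_gt (a := ε ^ q)
    (b := M * (⨆ n, X.nrm (u n)) ^ q) (ENNReal.rpow_pos_of_nonneg hε hq0.le).ne'
    (ENNReal.mul_ne_top ENNReal.coe_ne_top (ENNReal.rpow_ne_top_of_nonneg hq0.le htop))
  exact (hbound J).not_gt hJ

theorem iSup_rpow {q : ℝ} (hq : 0 < q) (u : ℕ → ℝ≥0∞) : (⨆ n, u n) ^ q = ⨆ n, u n ^ q :=
  (ENNReal.orderIsoRpow q hq).map_iSup u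

theorem IsConcave.powNrm_iSup_le {q : ℝ} (hq : 1 ≤ q) (hX : X.IsConcave q) {u : ℕ → Ω → ℝ≥0∞}
    (hu : ∀ n, Measurable (u n)) (hmono : ∀ ω, Monotone fun n => u n ω) :
    X.powNrm q (fun ω => ⨆ n, u n ω) ≤ ⨆ n, X.powNrm q (u n) := by
  have hq0 : 0 < q := by linarith
  have hq1 : 0 < 1 / q := by positivity
  simp only [powNrm, iSup_rpow hq1, ← iSup_rpow hq0]
  refine ENNReal.rpow_le_rpow ?_ hq0.le
  exact IsConcave.nrm_iSup_le hq hX (fun n => (hu n).pow_const _)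
    fun ω m n h => ENNReal.rpow_le_rpow (hmono ω h) hq1.le

theorem tendsto_powNrm_zero {q : ℝ} (hq : 0 < q) (hX : IsOrderContinuousNorm X.fnorm)
    {u : ℕ → Ω → ℝ≥0∞} (hu : ∀ n, Measurable (u n)) (h0 : X.powNrm q (u 0) < ∞)
    (hanti : ∀ ω, Antitone fun n => u n ω)
    (hlim : ∀ᵐ ω ∂μ, Tendsto (fun n => u n ω) atTop (𝓝 0)) :
    Tendsto (fun n => X.powNrm q (u n)) atTop (𝓝 0) := by
  have hq1 : 0 < 1 / q := by positivity
  let w : ℕ → Ω → ℝ≥0∞ := fun n ω => u n ω ^ (1 / q)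
  have hw : ∀ ω, Antitone fun n => w n ω := fun ω m n h =>
    ENNReal.rpow_le_rpow (hanti ω h) hq1.le
  have hlt : ∀ n, X.nrm (w n) < ∞ := fun n =>
    (X.nrm_mono (Eventually.of_forall fun ω => hw ω n.zero_le)).trans_lt
      ((X.powNrm_lt_top_iff hq).1 h0)
  choose f hf hf' using fun n => X.exists_carrier_enorm_eq ((hu n).pow_const (1 / q)) (hlt n)
  have hfin : ∀ n, ∀ᵐ ω ∂μ, w n ω < ∞ := fun n => X.ae_lt_top_of_nrm_lt_top (hlt n)
  have hlim' : Tendsto (fun n => X.fnorm (f n)) atTop (𝓝 0) := by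
    refine hX (fun n => f n) (fun n => (f n).2) (fun n => ?_) (fun m n hmn => ?_) ?_
    · rw [← AEEqFun.coeFn_le]
      filter_upwards [hf n, AEEqFun.coeFn_zero (α := Ω) (β := ℝ) (μ := μ)] with ω h1 h2
      rw [h1, h2]; exact ENNReal.toReal_nonneg
    · rw [← AEEqFun.coeFn_le]
      filter_upwards [hf n, hf m, hfin m] with ω h1 h2 h3
      rw [h1, h2]; exact ENNReal.toReal_mono h3.ne (hw ω hmn)
    · filter_upwards [ae_all_iff.2 hf, hlim] with ω h1 h2
      simp only [h1]
      have h3 := ((ENNReal.continuous_rpow_const (y := 1 / q)).tendsto 0).comp h2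
      rw [ENNReal.zero_rpow_of_pos hq1] at h3
      exact (ENNReal.tendsto_toReal ENNReal.zero_ne_top).comp h3
  have h4 := ((ENNReal.continuous_rpow_const (y := q)).tendsto 0).comp hlim'
  rw [ENNReal.zero_rpow_of_pos hq] at h4
  refine h4.congr fun n => ?_
  show X.fnorm (f n) ^ q = X.nrm (w n) ^ q
  rw [← X.nrm_enorm, X.nrm_congr (hf' n)]

end Convexity

section Regular

variable {Ω : Type u} [MeasurableSpace Ω] {μ : Measure Ω} {Ω' : Type v} [MeasurableSpace Ω']
    {ν : Measure Ω'} {X : BanachFunctionSpace μ} {Y : BanachFunctionSpace ν}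

/-- The estimate for a `p`-regular operator that is used in the separation argument. Hölder's
inequality with exponent `p / s` passes from `p`-th to `s`-th powers on the side of `Y`, and
`a^(1-θ) b^θ ≤ a + b` makes the result linear in the weights. -/
theorem exists_powNrm_sum_le_of_isPRegular {s p : ℝ} (hs : 1 ≤ s) (hsp : s ≤ p)
    {T : X.carrier →ₗ[ℝ] Y.carrier} (hT : IsPRegular p T) :
    ∃ C : ℝ≥0, ∀ (t : X.carrier →₀ ℝ≥0),
      Y.powNrm s (fun ω => ∑ x ∈ t.support, t x * ‖(T x : Ω' →ₘ[ν] ℝ) ω‖ₑ ^ s) ≤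
        C * (∑ x ∈ t.support, (t x : ℝ≥0∞) +
          X.powNrm p (fun ω => ∑ x ∈ t.support, t x * ‖(x : Ω →ₘ[μ] ℝ) ω‖ₑ ^ p)) := by
  obtain ⟨K, -, hK⟩ := hT
  have hs0 : 0 < s := by linarith
  have hp0 : 0 < p := by linarith
  refine ⟨K ^ s, fun t => ?_⟩
  set S := t.support
  set τ : ℝ≥0∞ := ∑ x ∈ S, (t x : ℝ≥0∞) with hτ
  have hτfin : τ ≠ ∞ := ENNReal.sum_ne_top.2 fun x _ => ENNReal.coe_ne_top
  set A := X.powNrm p (fun ω => ∑ x ∈ S, t x * ‖(x : Ω →ₘ[μ] ℝ) ω‖ₑ ^ p)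
  have hθ : 0 ≤ 1 - s / p := by rw [sub_nonneg, div_le_one hp0]; exact hsp
  have hsp0 : 0 < s / p := by positivity
  -- regularity for the vectors `t x ^ (1 / p) • x`
  have hreg : Y.powNrm p (fun ω => ∑ x ∈ S, t x * ‖(T x : Ω' →ₘ[ν] ℝ) ω‖ₑ ^ p) ≤ K ^ p * A := by
    have hscal : ∀ (c : ℝ≥0) (y : ℝ), ‖((c ^ (1 / p) : ℝ≥0) : ℝ) * y‖ₑ ^ p = c * ‖y‖ₑ ^ p := by
      intro c y
      rw [enorm_mul, ENNReal.mul_rpow_of_nonneg _ _ hp0.le]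
      congr 1
      rw [Real.enorm_eq_ofReal (NNReal.coe_nonneg _), ENNReal.ofReal_coe_nnreal,
        ENNReal.coe_rpow_of_nonneg _ (by positivity), ← ENNReal.rpow_mul,
        one_div_mul_cancel hp0.ne', ENNReal.rpow_one]
    let c : X.carrier → ℝ := fun x => ((t x ^ (1 / p) : ℝ≥0) : ℝ)
    let z : Fin S.card → X.carrier := fun j =>
      c (S.equivFin.symm j) • (S.equivFin.symm j : X.carrier)
    have h := ENNReal.rpow_le_rpow (hK S.card z) hp0.le
    rw [Y.fnorm_lpSum_rpow hp0, ENNReal.mul_rpow_of_nonneg _ _ hp0.le, X.fnorm_lpSum_rpow hp0] at h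
    convert h using 1
    · refine Y.powNrm_congr hp0 ?_
      filter_upwards [(ae_ball_iff S.countable_toSet).2 fun x _ =>
        AEEqFun.coeFn_smul (c x) (T x : Ω' →ₘ[ν] ℝ)] with ω hω
      simp only [z, map_smul, Submodule.coe_smul]
      rw [sum_equivFin S fun x => ‖(c x • (T x : Ω' →ₘ[ν] ℝ)) ω‖ₑ ^ p]
      refine Finset.sum_congr rfl fun x hx => ?_
      rw [hω x hx, Pi.smul_apply, smul_eq_mul, hscal]
    · congr 1
      refine X.powNrm_congr hp0 ?_
      filter_upwards [(ae_ball_iff S.countable_toSet).2 fun x _ =>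
        AEEqFun.coeFn_smul (c x) (x : Ω →ₘ[μ] ℝ)] with ω hω
      simp only [z, Submodule.coe_smul]
      rw [sum_equivFin S fun x => ‖(c x • (x : Ω →ₘ[μ] ℝ)) ω‖ₑ ^ p]
      refine Finset.sum_congr rfl fun x hx => ?_
      rw [hω x hx, Pi.smul_apply, smul_eq_mul, hscal]
  have hτc : ((τ ^ (1 - s / p)).toNNReal : ℝ≥0∞) = τ ^ (1 - s / p) :=
    ENNReal.coe_toNNReal (ENNReal.rpow_ne_top_of_nonneg hθ hτfin)
  -- Hölder's inequality for the weights `t`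
  have hholder : ∀ ω, ∑ x ∈ S, t x * ‖(T x : Ω' →ₘ[ν] ℝ) ω‖ₑ ^ s ≤ τ ^ (1 - s / p) *
      (∑ x ∈ S, t x * ‖(T x : Ω' →ₘ[ν] ℝ) ω‖ₑ ^ p) ^ (s / p) := by
    intro ω
    have h := ENNReal.inner_le_weight_mul_Lp_of_nonneg S (p := p / s)
      (by rw [le_div_iff₀ hs0]; linarith) (fun x => (t x : ℝ≥0∞))
      (fun x => ‖(T x : Ω' →ₘ[ν] ℝ) ω‖ₑ ^ s)
    simp only [inv_div, ← ENNReal.rpow_mul, mul_div_cancel₀ _ hs0.ne'] at h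
    exact h
  have hpow : Y.powNrm s (fun ω => (∑ x ∈ S, t x * ‖(T x : Ω' →ₘ[ν] ℝ) ω‖ₑ ^ p) ^ (s / p)) =
      Y.powNrm p (fun ω => ∑ x ∈ S, t x * ‖(T x : Ω' →ₘ[ν] ℝ) ω‖ₑ ^ p) ^ (s / p) := by
    simp only [powNrm, ← ENNReal.rpow_mul]
    rw [show p * (s / p) = s by field_simp, show s / p * (1 / s) = 1 / p by field_simp]
  calc _ ≤ Y.powNrm s (fun ω => (τ ^ (1 - s / p)).toNNReal *
          (∑ x ∈ S, t x * ‖(T x : Ω' →ₘ[ν] ℝ) ω‖ₑ ^ p) ^ (s / p)) :=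
        Y.powNrm_mono hs0 (Eventually.of_forall fun ω => by rw [hτc]; exact hholder ω)
    _ = τ ^ (1 - s / p) *
          Y.powNrm p (fun ω => ∑ x ∈ S, t x * ‖(T x : Ω' →ₘ[ν] ℝ) ω‖ₑ ^ p) ^ (s / p) := by
        rw [Y.powNrm_smul hs0, hpow, hτc]
    _ ≤ τ ^ (1 - s / p) * (K ^ p * A) ^ (s / p) := by gcongr
    _ = K ^ s * (τ ^ (1 - s / p) * A ^ (s / p)) := by
        rw [ENNReal.mul_rpow_of_nonneg _ _ hsp0.le, ← ENNReal.rpow_mul,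
          show p * (s / p) = s by field_simp]
        ring
    _ ≤ K ^ s * ((τ + A) ^ (1 - s / p) * (τ + A) ^ (s / p)) := by
        gcongr
        · exact le_self_add
        · exact le_add_self
    _ = _ := by
        rw [← ENNReal.rpow_add_of_nonneg _ _ hθ hsp0.le, sub_add_cancel, ENNReal.rpow_one,
          ENNReal.coe_rpow_of_nonneg _ hs0.le]

end Regular
end BanachFunctionSpace

/-! ### A Hahn–Banach theorem for systems of linear inequalities -/

/-- A system of linear inequalities `L (v w) ≤ c w`, indexed by the elements `w` of a cone, has a
solution `L` as soon as no positive combination of the inequalities reads `0 ≤ r` with `r < 0`.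
The inequality is only obtained for those `w` for which `-v w` is in the range of `v` as well. -/
theorem exists_linearMap_le {W V : Type*} [AddCommMonoid W] [Module ℝ≥0 W] [AddCommGroup V]
    [Module ℝ V] (v : W →ₗ[ℝ≥0] V) (c : W →ₗ[ℝ≥0] ℝ) (h : ∀ w, v w = 0 → 0 ≤ c w) :
    ∃ L : V →ₗ[ℝ] ℝ, ∀ w w', v w + v w' = 0 → L (v w) ≤ c w := by
  let V₀ : Submodule ℝ V :=
    { carrier := {x | (∃ w, v w = x) ∧ ∃ w, v w = -x}
      zero_mem' := ⟨⟨0, map_zero v⟩, ⟨0, by simp⟩⟩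
      add_mem' := by
        rintro _ _ ⟨⟨a, rfl⟩, a', ha⟩ ⟨⟨b, rfl⟩, b', hb⟩
        exact ⟨⟨a + b, map_add v a b⟩, a' + b', by rw [map_add, ha, hb, neg_add]⟩
      smul_mem' := by
        rintro r _ ⟨⟨a, rfl⟩, a', ha⟩
        rcases le_total 0 r with hr | hr
        · lift r to ℝ≥0 using hr
          refine ⟨⟨r • a, map_smul v r a⟩, r • a', ?_⟩
          rw [map_smul, ha, smul_neg]; rfl
        · obtain ⟨r, rfl⟩ : ∃ ρ : ℝ≥0, r = -ρ :=
            ⟨(-r).toNNReal, by rw [Real.coe_toNNReal _ (neg_nonneg.2 hr), neg_neg]⟩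
          refine ⟨⟨r • a', ?_⟩, r • a, ?_⟩
          · rw [map_smul, ha, NNReal.smul_def, smul_neg, neg_smul]
          · rw [map_smul, NNReal.smul_def, neg_smul, neg_neg] }
  let K : PointedCone ℝ (V₀ × ℝ) :=
    { carrier := {z | ∃ w, v w = z.1 ∧ c w ≤ z.2}
      zero_mem' := ⟨0, by simp⟩
      add_mem' := by
        rintro a b ⟨w, hw, hw'⟩ ⟨z, hz, hz'⟩
        exact ⟨w + z, by simp [hw, hz], by simpa using add_le_add hw' hz'⟩
      smul_mem' := by
        rintro ⟨r, hr⟩ a ⟨w, hw, hw'⟩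
        let ρ : ℝ≥0 := ⟨r, hr⟩
        refine ⟨ρ • w, ?_, ?_⟩
        · rw [map_smul, hw]; rfl
        · rw [map_smul]; exact mul_le_mul_of_nonneg_left hw' hr }
  let f : V₀ × ℝ →ₗ.[ℝ] ℝ :=
    ⟨Submodule.prod ⊥ ⊤, (LinearMap.snd ℝ V₀ ℝ).comp (Submodule.subtype _)⟩
  obtain ⟨g, hgf, hg⟩ := riesz_extension K f (by
      rintro ⟨⟨x, r⟩, hx⟩ ⟨w, hw, hwr⟩
      have hx0 : x = 0 := (Submodule.mem_prod.1 hx).1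
      subst hx0
      exact (h w hw).trans hwr) (by
      rintro ⟨x, r⟩
      obtain ⟨w, hw⟩ := x.2.1
      refine ⟨⟨(0, c w - r), Submodule.mem_prod.2 ⟨Submodule.zero_mem _, trivial⟩⟩, w, ?_, ?_⟩
      · simp [hw]
      · simp)
  have hg1 : ∀ r : ℝ, g (0, r) = r := fun r =>
    hgf ⟨(0, r), Submodule.mem_prod.2 ⟨Submodule.zero_mem _, trivial⟩⟩
  obtain ⟨L, hL⟩ := LinearMap.exists_extend (-(g.comp (LinearMap.inl ℝ V₀ ℝ)))
  refine ⟨L, fun w w' hww => ?_⟩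
  have hmem : v w ∈ V₀ := ⟨⟨w, rfl⟩, w', eq_neg_of_add_eq_zero_right hww⟩
  have h1 : L (v w) = -g (⟨v w, hmem⟩, 0) := LinearMap.congr_fun hL ⟨v w, hmem⟩
  have h2 : 0 ≤ g (⟨v w, hmem⟩, c w) := hg _ ⟨w, rfl, le_rfl⟩
  have h3 : ((⟨v w, hmem⟩, c w) : V₀ × ℝ) = (⟨v w, hmem⟩, 0) + (0, c w) := by simp
  rw [h3, map_add, hg1] at h2
  rw [h1]; linarith

/-! ### The countably additive part of a positive functional -/

section CountablyAdditivePart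

variable {Ω : Type u} [MeasurableSpace Ω]

open scoped Classical in
/-- The finitely additive set function induced by a positive functional on simple functions,
extended by `∞` to the sets that are not measurable. -/
noncomputable def simpleContent (P : SimpleFunc Ω ℝ≥0 →ₗ[ℝ≥0] ℝ≥0) (S : Set Ω) : ℝ≥0∞ :=
  if MeasurableSet S then P ((SimpleFunc.const Ω 1).restrict S) else ∞

variable (P : SimpleFunc Ω ℝ≥0 →ₗ[ℝ≥0] ℝ≥0)

theorem simpleContent_of_measurableSet {S : Set Ω} (hS : MeasurableSet S) :
    simpleContent P S = P ((SimpleFunc.const Ω 1).restrict S) := if_pos hS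

theorem simpleContent_empty : simpleContent P ∅ = 0 := by
  rw [simpleContent_of_measurableSet P MeasurableSet.empty, SimpleFunc.restrict_empty, map_zero,
    ENNReal.coe_zero]

theorem simpleFunc_monotone : Monotone P := by
  intro g h hgh
  have : h = g + (h - g) := by
    ext ω; simp [add_tsub_cancel_of_le (hgh ω)]
  rw [this, map_add]
  exact le_self_add

/-- The measure generated by the countable covers of a set, measured by a finitely additive set
function: this is the largest measure below it. -/
noncomputable def countablyAdditivePart : Measure Ω :=
  (OuterMeasure.ofFunction (simpleContent P) (simpleContent_empty P)).toMeasure (by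
    intro S hS
    refine OuterMeasure.ofFunction_caratheodory fun t => ?_
    by_cases ht : MeasurableSet t
    · rw [simpleContent_of_measurableSet P (ht.inter hS),
        simpleContent_of_measurableSet P (ht.diff hS), simpleContent_of_measurableSet P ht,
        ← ENNReal.coe_add, ← map_add]
      refine le_of_eq ?_
      congr 2
      ext ω
      rw [SimpleFunc.coe_add, Pi.add_apply, SimpleFunc.restrict_apply _ (ht.inter hS),
        SimpleFunc.restrict_apply _ (ht.diff hS), SimpleFunc.restrict_apply _ ht]
      by_cases h1 : ω ∈ t <;> by_cases h2 : ω ∈ S <;> simp [h1, h2]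
    · rw [simpleContent, simpleContent, simpleContent, if_neg ht]; exact le_top)

theorem countablyAdditivePart_le {S : Set Ω} (hS : MeasurableSet S) :
    countablyAdditivePart P S ≤ P ((SimpleFunc.const Ω 1).restrict S) := by
  rw [countablyAdditivePart, toMeasure_apply _ _ hS, ← simpleContent_of_measurableSet P hS]
  exact OuterMeasure.ofFunction_le S

theorem lintegral_simpleFunc_add (m : Measure Ω) (g h : SimpleFunc Ω ℝ≥0) :
    ∫⁻ ω, ((g + h) ω : ℝ≥0∞) ∂m = ∫⁻ ω, (g ω : ℝ≥0∞) ∂m + ∫⁻ ω, (h ω : ℝ≥0∞) ∂m := by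
  rw [← lintegral_add_left g.measurable.coe_nnreal_ennreal]
  simp

theorem lintegral_piecewise_const (m : Measure Ω) (c : ℝ≥0) {S : Set Ω} (hS : MeasurableSet S) :
    ∫⁻ ω, (SimpleFunc.piecewise S hS (SimpleFunc.const Ω c) (SimpleFunc.const Ω 0) ω : ℝ≥0∞) ∂m =
      c * m S := by
  rw [← lintegral_indicator_const hS]
  refine lintegral_congr fun ω => ?_
  by_cases h : ω ∈ S <;> simp [h]

theorem piecewise_const_eq (c : ℝ≥0) {S : Set Ω} (hS : MeasurableSet S) :
    SimpleFunc.piecewise S hS (SimpleFunc.const Ω c) (SimpleFunc.const Ω 0) =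
      c • (SimpleFunc.const Ω 1).restrict S := by
  ext ω
  rw [SimpleFunc.coe_smul, Pi.smul_apply, SimpleFunc.restrict_apply _ hS]
  by_cases h : ω ∈ S <;> simp [h]

theorem lintegral_countablyAdditivePart_le (g : SimpleFunc Ω ℝ≥0) :
    ∫⁻ ω, (g ω : ℝ≥0∞) ∂(countablyAdditivePart P) ≤ P g := by
  induction g using SimpleFunc.induction with
  | const c hS =>
    rw [lintegral_piecewise_const, piecewise_const_eq, map_smul, smul_eq_mul, ENNReal.coe_mul]
    gcongr
    exact countablyAdditivePart_le P hS
  | add _ hg hh =>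
    rw [lintegral_simpleFunc_add, map_add, ENNReal.coe_add]
    exact add_le_add hg hh

theorem restrict_mono_set (g : SimpleFunc Ω ℝ≥0) {A B : Set Ω} (hA : MeasurableSet A)
    (hB : MeasurableSet B) (h : A ⊆ B) : g.restrict A ≤ g.restrict B := by
  intro ω
  rw [SimpleFunc.restrict_apply _ hA, SimpleFunc.restrict_apply _ hB]
  exact Set.indicator_le_indicator_of_subset h (fun _ => bot_le) ω

/-- Up to `ε`, the integral against the countably additive part is at least the value of the
functional on restrictions to sets that exhaust the space. -/
theorem exists_exhaustion_le_lintegral (g : SimpleFunc Ω ℝ≥0) :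
    ∀ ε : ℝ≥0, 0 < ε → ∃ B : ℕ → Set Ω, (∀ n, MeasurableSet (B n)) ∧ Monotone B ∧
      (∀ ω, ∃ n, ω ∈ B n) ∧
      ∀ n, (P (g.restrict (B n)) : ℝ≥0∞) ≤ ∫⁻ ω, (g ω : ℝ≥0∞) ∂(countablyAdditivePart P) + ε := by
  induction g using SimpleFunc.induction with
  | @const c S hS =>
    intro ε hε
    have hfin : countablyAdditivePart P S ≠ ∞ :=
      ((countablyAdditivePart_le P hS).trans_lt ENNReal.coe_lt_top).ne
    have hδ : (0 : ℝ≥0∞) < ((ε / (c + 1) : ℝ≥0) : ℝ≥0∞) := by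
      rw [ENNReal.coe_pos]; positivity
    have hlt := ENNReal.lt_add_right hfin hδ.ne'
    nth_rewrite 1 [countablyAdditivePart] at hlt
    rw [toMeasure_apply _ _ hS, OuterMeasure.ofFunction_apply] at hlt
    obtain ⟨t, ht, htlt⟩ := by simpa only [iInf_lt_iff] using hlt
    have htm : ∀ n, MeasurableSet (t n) := by
      intro n
      by_contra hn
      have h1 : simpleContent P (t n) = ∞ := if_neg hn
      have h2 := (ENNReal.le_tsum (f := fun n => simpleContent P (t n)) n).trans_lt htlt
      rw [h1] at h2
      exact not_top_lt h2
    let U : ℕ → Set Ω := fun n => ⋃ j ∈ Finset.range n, t j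
    have hU : ∀ n, MeasurableSet (U n) := fun n =>
      Finset.measurableSet_biUnion _ fun j _ => htm j
    have hPU : ∀ n, (P ((SimpleFunc.const Ω 1).restrict (U n)) : ℝ≥0∞) ≤
        ∑ j ∈ Finset.range n, simpleContent P (t j) := by
      intro n
      induction n with
      | zero => simp [U]
      | succ n ih =>
        rw [Finset.sum_range_succ, simpleContent_of_measurableSet P (htm n)]
        refine le_trans ?_ (add_le_add ih le_rfl)
        rw [← ENNReal.coe_add, ← map_add, ENNReal.coe_le_coe]
        refine simpleFunc_monotone P fun ω => ?_
        rw [SimpleFunc.coe_add, Pi.add_apply, SimpleFunc.restrict_apply _ (hU (n + 1)),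
          SimpleFunc.restrict_apply _ (hU n), SimpleFunc.restrict_apply _ (htm n)]
        have h3 : U (n + 1) = U n ∪ t n := by
          simp only [U, Finset.range_add_one, Finset.set_biUnion_insert, Set.union_comm]
        rw [h3]
        by_cases h1 : ω ∈ U n <;> by_cases h2 : ω ∈ t n <;> simp [h1, h2]
    refine ⟨fun n => Sᶜ ∪ U n, fun n => hS.compl.union (hU n), fun m n hmn => ?_, fun ω => ?_,
      fun n => ?_⟩
    · exact Set.union_subset_union_right _
        (Set.biUnion_subset_biUnion_left (Finset.range_mono hmn))
    · by_cases hω : ω ∈ S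
      · obtain ⟨j, hj⟩ := Set.mem_iUnion.1 (ht hω)
        exact ⟨j + 1, Or.inr (Set.mem_biUnion (Finset.self_mem_range_succ j) hj)⟩
      · exact ⟨0, Or.inl hω⟩
    · have h1 : (SimpleFunc.piecewise S hS (SimpleFunc.const Ω c) (SimpleFunc.const Ω 0)).restrict
          (Sᶜ ∪ U n) ≤ c • (SimpleFunc.const Ω 1).restrict (U n) := by
        intro ω
        rw [SimpleFunc.coe_smul, Pi.smul_apply, SimpleFunc.restrict_apply _ (hU n),
          SimpleFunc.restrict_apply _ (hS.compl.union (hU n))]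
        by_cases h1 : ω ∈ S <;> by_cases h2 : ω ∈ U n <;> simp [h1, h2]
      rw [lintegral_piecewise_const]
      calc _ ≤ ((P (c • (SimpleFunc.const Ω 1).restrict (U n)) : ℝ≥0) : ℝ≥0∞) :=
            ENNReal.coe_le_coe.2 (simpleFunc_monotone P h1)
        _ = c * P ((SimpleFunc.const Ω 1).restrict (U n)) := by
            rw [map_smul, smul_eq_mul, ENNReal.coe_mul]
        _ ≤ c * (countablyAdditivePart P S + ((ε / (c + 1) : ℝ≥0) : ℝ≥0∞)) := by
            gcongr
            exact ((hPU n).trans (ENNReal.sum_le_tsum _)).trans htlt.le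
        _ ≤ c * countablyAdditivePart P S + ε := by
            rw [mul_add]
            gcongr
            rw [← ENNReal.coe_mul, ENNReal.coe_le_coe, ← mul_div_assoc,
              div_le_iff₀ (by positivity), mul_comm]
            gcongr
            exact le_self_add
  | @add g h _ hg hh =>
    intro ε hε
    obtain ⟨B, hB, hBm, hBu, hBP⟩ := hg (ε / 2) (by positivity)
    obtain ⟨C, hC, hCm, hCu, hCP⟩ := hh (ε / 2) (by positivity)
    refine ⟨fun n => B n ∩ C n, fun n => (hB n).inter (hC n), fun m n hmn =>
      Set.inter_subset_inter (hBm hmn) (hCm hmn), fun ω => ?_, fun n => ?_⟩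
    · obtain ⟨m, hm⟩ := hBu ω
      obtain ⟨n, hn⟩ := hCu ω
      exact ⟨max m n, hBm (le_max_left m n) hm, hCm (le_max_right m n) hn⟩
    · have h1 : (g + h).restrict (B n ∩ C n) ≤ g.restrict (B n) + h.restrict (C n) := by
        intro ω
        rw [SimpleFunc.coe_add, Pi.add_apply, SimpleFunc.restrict_apply _ (hB n),
          SimpleFunc.restrict_apply _ (hC n), SimpleFunc.restrict_apply _ ((hB n).inter (hC n))]
        by_cases h1 : ω ∈ B n <;> by_cases h2 : ω ∈ C n <;> simp [h1, h2]
      calc _ ≤ ((P (g.restrict (B n) + h.restrict (C n)) : ℝ≥0) : ℝ≥0∞) :=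
            ENNReal.coe_le_coe.2 (simpleFunc_monotone P h1)
        _ = P (g.restrict (B n)) + P (h.restrict (C n)) := by rw [map_add, ENNReal.coe_add]
        _ ≤ _ := add_le_add (hBP n) (hCP n)
        _ = _ := by
          rw [lintegral_simpleFunc_add, add_add_add_comm, ← ENNReal.coe_add, add_halves]

/-- A functional that is dominated by a positive linear functional and is continuous along
exhaustions is dominated by its countably additive part. -/
theorem le_lintegral_countablyAdditivePart {N : SimpleFunc Ω ℝ≥0 → ℝ≥0∞} (hN : ∀ g, N g ≤ P g)
    (hNc : ∀ (g : SimpleFunc Ω ℝ≥0) (B : ℕ → Set Ω), (∀ n, MeasurableSet (B n)) → Monotone B →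
      (∀ ω, ∃ n, ω ∈ B n) → N g ≤ ⨆ n, N (g.restrict (B n))) (g : SimpleFunc Ω ℝ≥0) :
    N g ≤ ∫⁻ ω, (g ω : ℝ≥0∞) ∂(countablyAdditivePart P) := by
  refine ENNReal.le_of_forall_pos_le_add fun ε hε _ => ?_
  obtain ⟨B, hB, hBm, hBu, hBP⟩ := exists_exhaustion_le_lintegral P g ε hε
  exact (hNc g B hB hBm hBu).trans (iSup_le fun n => (hN _).trans (hBP n))

/-- Let `ψ` be a positive linear functional on a solid set `D` of nonnegative functions with a
strictly positive element `e`, vanishing on null functions, and let `N ≤ ψ` on `D` be continuous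
along increasing sequences. Then a functional given by a density lies between `N` and `ψ`. -/
theorem exists_density_between {μ : Measure Ω} [SigmaFinite μ] {D : Set (Ω → ℝ≥0)}
    {ψ : (Ω → ℝ) →ₗ[ℝ] ℝ} {N : (Ω → ℝ≥0) → ℝ≥0∞} {e : Ω → ℝ≥0} (he : Measurable e)
    (he0 : ∀ ω, 0 < e ω) (heD : ∀ (c : ℝ≥0) (u : Ω → ℝ≥0), Measurable u →
      (∀ ω, u ω ≤ c * e ω) → u ∈ D)
    (hDm : ∀ u ∈ D, Measurable u)
    (hDs : ∀ u ∈ D, ∀ v : Ω → ℝ≥0, Measurable v → (∀ ω, v ω ≤ u ω) → v ∈ D)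
    (hpos : ∀ u ∈ D, 0 ≤ ψ (fun ω => u ω)) (hnull : ∀ u ∈ D, (∀ᵐ ω ∂μ, u ω = 0) →
      ψ (fun ω => u ω) ≤ 0)
    (hN : ∀ u ∈ D, N u ≤ ENNReal.ofReal (ψ fun ω => u ω))
    (hNc : ∀ (u : ℕ → Ω → ℝ≥0) (U : Ω → ℝ≥0), U ∈ D → (∀ n, u n ∈ D) →
      (∀ ω, Monotone fun n => u n ω) → (∀ ω, ⨆ n, (u n ω : ℝ≥0∞) = U ω) → N U ≤ ⨆ n, N (u n)) :
    ∃ w : Ω → ℝ≥0, Measurable w ∧ ∀ u ∈ D, N u ≤ ∫⁻ ω, u ω * w ω ∂μ ∧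
      ∫⁻ ω, u ω * w ω ∂μ ≤ ENNReal.ofReal (ψ fun ω => u ω) := by
  have hgD : ∀ g : SimpleFunc Ω ℝ≥0, (fun ω => g ω * e ω) ∈ D := fun g => by
    obtain ⟨c, hc⟩ := g.exists_forall_le
    exact heD c _ (g.measurable.mul he) fun ω => mul_le_mul_left (hc ω) _
  have hψmono : ∀ u ∈ D, ∀ v ∈ D, (∀ ω, u ω ≤ v ω) → ψ (fun ω => u ω) ≤ ψ (fun ω => v ω) := by
    intro u hu v hv huv
    have h1 := hpos (fun ω => v ω - u ω) (hDs v hv _ ((hDm v hv).sub (hDm u hu))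
      fun ω => tsub_le_self)
    have h2 : (fun ω => ((v ω - u ω : ℝ≥0) : ℝ)) =
        (fun ω => (v ω : ℝ)) - (fun ω => (u ω : ℝ)) := by
      ext ω; simp [NNReal.coe_sub (huv ω)]
    rw [h2, map_sub] at h1
    linarith
  let P : SimpleFunc Ω ℝ≥0 →ₗ[ℝ≥0] ℝ≥0 :=
    { toFun := fun g => ⟨ψ (fun ω => ((g ω * e ω : ℝ≥0) : ℝ)), hpos _ (hgD g)⟩
      map_add' := fun g h => by
        have h1 : (fun ω => (((g + h) ω * e ω : ℝ≥0) : ℝ)) =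
            (fun ω => ((g ω * e ω : ℝ≥0) : ℝ)) + fun ω => ((h ω * e ω : ℝ≥0) : ℝ) := by
          ext ω; simp [add_mul]
        exact NNReal.eq ((congrArg ψ h1).trans (map_add ψ _ _))
      map_smul' := fun r g => by
        have h1 : (fun ω => (((r • g) ω * e ω : ℝ≥0) : ℝ)) =
            (r : ℝ) • fun ω => ((g ω * e ω : ℝ≥0) : ℝ) := by
          ext ω; simp [mul_assoc]
        exact NNReal.eq ((congrArg ψ h1).trans (map_smul ψ _ _)) }
  have hP : ∀ g, (P g : ℝ≥0∞) = ENNReal.ofReal (ψ (fun ω => ((g ω * e ω : ℝ≥0) : ℝ))) := fun g => by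
    rw [← ENNReal.ofReal_coe_nnreal]; rfl
  set m := countablyAdditivePart P with hm
  have hmfin : IsFiniteMeasure m :=
    ⟨(countablyAdditivePart_le P MeasurableSet.univ).trans_lt ENNReal.coe_lt_top⟩
  have hac : m ≪ μ := by
    refine Measure.AbsolutelyContinuous.mk fun S hS hμS => ?_
    refine le_antisymm ((countablyAdditivePart_le P hS).trans ?_) bot_le
    rw [hP, ENNReal.ofReal_eq_zero.2]
    refine hnull _ (hgD _) ?_
    filter_upwards [measure_eq_zero_iff_ae_notMem.1 hμS] with ω hω
    rw [SimpleFunc.restrict_apply _ hS, Set.indicator_of_notMem hω, zero_mul]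
  have hlow := le_lintegral_countablyAdditivePart P (N := fun g => N fun ω => g ω * e ω)
    (fun g => (hN _ (hgD g)).trans (hP g).ge) (fun g B hB hBm hBu => by
      refine hNc _ _ (hgD g) (fun n => hgD _) (fun ω i j hij => ?_) fun ω => ?_
      · exact mul_le_mul_left (restrict_mono_set g (hB i) (hB j) (hBm hij) ω) _
      · refine le_antisymm (iSup_le fun n => ?_) ?_
        · rw [ENNReal.coe_le_coe, SimpleFunc.restrict_apply _ (hB n)]
          exact mul_le_mul_left (Set.indicator_le_self' (fun _ _ => bot_le) ω) _
        · obtain ⟨n, hn⟩ := hBu ω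
          refine le_iSup_of_le n ?_
          rw [SimpleFunc.restrict_apply _ (hB n), Set.indicator_of_mem hn])
  have hup := lintegral_countablyAdditivePart_le P
  rw [← hm] at hlow hup
  refine ⟨fun ω => (m.rnDeriv μ ω).toNNReal / e ω,
    (Measure.measurable_rnDeriv m μ).ennreal_toNNReal.div he, fun u hu => ?_⟩
  have hum : Measurable u := hDm u hu
  have hint : ∫⁻ ω, u ω * (((m.rnDeriv μ ω).toNNReal / e ω : ℝ≥0) : ℝ≥0∞) ∂μ =
      ∫⁻ ω, ((u ω / e ω : ℝ≥0) : ℝ≥0∞) ∂m := by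
    refine Eq.trans ?_ (lintegral_rnDeriv_mul hac (hum.div he).coe_nnreal_ennreal.aemeasurable)
    refine lintegral_congr_ae ?_
    filter_upwards [Measure.rnDeriv_lt_top m μ] with ω hω
    nth_rewrite 2 [← ENNReal.coe_toNNReal hω.ne]
    rw [← ENNReal.coe_mul, ← ENNReal.coe_mul]
    congr 1
    rw [mul_div_assoc', mul_div_assoc', mul_comm]
  rw [hint]
  -- approximate `u / e` from below by simple functions
  let F : Ω → ℝ≥0∞ := fun ω => ((u ω / e ω : ℝ≥0) : ℝ≥0∞)
  have hF : Measurable F := (hum.div he).coe_nnreal_ennreal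
  let g : ℕ → SimpleFunc Ω ℝ≥0 := fun n => (SimpleFunc.eapprox F n).map ENNReal.toNNReal
  have hg : ∀ n ω, (g n ω : ℝ≥0∞) = SimpleFunc.eapprox F n ω := fun n ω =>
    ENNReal.coe_toNNReal (SimpleFunc.eapprox_lt_top F n ω).ne
  have hgmono : ∀ ω, Monotone fun n => g n ω := fun ω i j hij => by
    rw [← ENNReal.coe_le_coe, hg, hg]; exact SimpleFunc.monotone_eapprox F hij ω
  have hgsup : ∀ ω, ⨆ n, (g n ω : ℝ≥0∞) = F ω := fun ω => by
    simp only [hg]; exact SimpleFunc.iSup_eapprox_apply hF ω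
  have hgint : ∫⁻ ω, F ω ∂m = ⨆ n, ∫⁻ ω, (g n ω : ℝ≥0∞) ∂m := by
    simp only [← hgsup]
    exact lintegral_iSup (fun n => (g n).measurable.coe_nnreal_ennreal)
      fun i j hij ω => ENNReal.coe_le_coe.2 (hgmono ω hij)
  have hgu : ∀ n ω, g n ω * e ω ≤ u ω := fun n ω => by
    have h1 : (g n ω : ℝ≥0∞) ≤ F ω := (le_iSup (fun n => (g n ω : ℝ≥0∞)) n).trans (hgsup ω).le
    rwa [ENNReal.coe_le_coe, le_div_iff₀ (he0 ω)] at h1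
  rw [show (∫⁻ ω, ((u ω / e ω : ℝ≥0) : ℝ≥0∞) ∂m) = _ from hgint]
  constructor
  · refine (hNc (fun n ω => g n ω * e ω) u hu (fun n => hgD _)
      (fun ω i j hij => mul_le_mul_left (hgmono ω hij) _) fun ω => ?_).trans
      (iSup_mono fun n => hlow (g n))
    simp only [ENNReal.coe_mul]
    rw [← ENNReal.iSup_mul, hgsup ω, ← ENNReal.coe_mul, div_mul_cancel₀ _ (he0 ω).ne']
  · refine iSup_le fun n => (hup (g n)).trans ?_
    rw [hP]
    exact ENNReal.ofReal_le_ofReal (hψmono _ (hgD _) u hu (hgu n))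

end CountablyAdditivePart

/-! ### Separation: finitely additive weights -/

namespace BanachFunctionSpace

section Separation

variable {Ω : Type u} [MeasurableSpace Ω] {μ : Measure Ω} {Ω' : Type v} [MeasurableSpace Ω']
    {ν : Measure Ω'} {X : BanachFunctionSpace μ} {Y : BanachFunctionSpace ν}

/-- The inequality showing that the linear inequalities imposed on the two functionals in
`exists_functionals` are consistent. -/
theorem exists_sum_powNrm_le_of_regular {s p : ℝ} (hs : 1 ≤ s) (hsp : s ≤ p)
    (hX : X.IsConvex p) (hY : Y.IsConcave s) {T : X.carrier →ₗ[ℝ] Y.carrier}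
    (hT : IsPRegular p T) {e : Ω' → ℝ≥0} (he : Y.powNrm s (fun ω => e ω) < ∞) :
    ∃ C : ℝ≥0, ∀ {I : Type u} {J : Type v} {B : Type v} (a : I → Ω → ℝ≥0) (b : J → Ω' → ℝ≥0)
      (β : B → Ω' → ℝ≥0) (t : X.carrier →₀ ℝ≥0) (r : I →₀ ℝ≥0) (ρ : J →₀ ℝ≥0) (σ : B →₀ ℝ≥0),
      (∀ i, Measurable (a i)) → (∀ i, X.powNrm p (fun ω => a i ω) < ∞) →
      (∀ j, Measurable (b j)) → (∀ j, Y.powNrm s (fun ω => b j ω) < ∞) →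
      (∀ k, ∀ᵐ ω ∂ν, β k ω ≤ e ω) →
      (∀ ω, ∑ x ∈ t.support, t x * ‖(x : Ω →ₘ[μ] ℝ) ω‖₊ ^ p ≤ ∑ i ∈ r.support, r i * a i ω) →
      (∀ ω, ∑ j ∈ ρ.support, ρ j * b j ω ≤ ∑ x ∈ t.support, t x * ‖(T x : Ω' →ₘ[ν] ℝ) ω‖₊ ^ s +
        ∑ k ∈ σ.support, σ k * β k ω) →
      ∑ j ∈ ρ.support, ρ j * Y.powNrm s (fun ω => b j ω) ≤ C * (∑ x ∈ t.support, (t x : ℝ≥0∞) +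
        ∑ i ∈ r.support, r i * X.powNrm p (fun ω => a i ω) + ∑ k ∈ σ.support, (σ k : ℝ≥0∞)) := by
  have hs0 : 0 < s := by linarith
  have hp0 : 0 < p := by linarith
  obtain ⟨MX, hMX⟩ := IsConvex.exists_powNrm_sum_le.{u, u} hp0 hX
  obtain ⟨MY, hMY⟩ := IsConcave.exists_sum_powNrm_le.{v, v} hs0 hY
  obtain ⟨K, hK⟩ := exists_powNrm_sum_le_of_isPRegular hs hsp hT
  set E : ℝ≥0 := (Y.powNrm s (fun ω => e ω)).toNNReal with hE
  have hEe : (E : ℝ≥0∞) = Y.powNrm s (fun ω => e ω) := ENNReal.coe_toNNReal he.ne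
  refine ⟨MY * (2 ^ (s - 1) * (K * (1 + MX) + E)), ?_⟩
  intro I J B a b β t r ρ σ ham hafin hbm hbfin hβ h1 h2
  set τ : ℝ≥0∞ := ∑ x ∈ t.support, (t x : ℝ≥0∞)
  set R : ℝ≥0∞ := ∑ i ∈ r.support, r i * X.powNrm p (fun ω => a i ω) with hR
  set σ' : ℝ≥0 := ∑ k ∈ σ.support, σ k with hσ'
  have hσ : (∑ k ∈ σ.support, (σ k : ℝ≥0∞)) = σ' := by rw [hσ', ENNReal.ofNNReal_finsetSum]
  have h2c : ((2 ^ (s - 1) : ℝ≥0) : ℝ≥0∞) = 2 ^ (s - 1) := by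
    rw [ENNReal.coe_rpow_of_nonneg _ (by linarith)]; rfl
  have hA : X.powNrm p (fun ω => ∑ x ∈ t.support, t x * ‖(x : Ω →ₘ[μ] ℝ) ω‖ₑ ^ p) ≤ MX * R := by
    have h3 := hMX r.support (fun i ω => r i * a i ω) (fun i => by have := ham i; fun_prop)
      fun i => by
        rw [X.powNrm_smul hp0]
        exact ENNReal.mul_lt_top ENNReal.coe_lt_top (hafin i)
    simp only [X.powNrm_smul hp0, ← hR] at h3
    refine (X.powNrm_mono hp0 (Eventually.of_forall fun ω => ?_)).trans h3
    have h4 := ENNReal.coe_le_coe.2 (h1 ω)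
    push_cast at h4
    simpa only [ENNReal.coe_rpow_of_nonneg _ hp0.le, ← enorm_eq_nnnorm] using h4
  have hB : Y.powNrm s (fun ω => ∑ j ∈ ρ.support, ρ j * (b j ω : ℝ≥0∞)) ≤ 2 ^ (s - 1) *
      (Y.powNrm s (fun ω => ∑ x ∈ t.support, t x * ‖(T x : Ω' →ₘ[ν] ℝ) ω‖ₑ ^ s) + σ' * E) := by
    rw [hEe, ← Y.powNrm_smul hs0]
    refine le_trans (Y.powNrm_mono hs0 ?_) (Y.powNrm_add_le hs _ _)
    filter_upwards [(ae_ball_iff σ.support.countable_toSet).2 fun k _ => hβ k] with ω hω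
    have h4 := ENNReal.coe_le_coe.2 (h2 ω)
    push_cast at h4
    simp only [ENNReal.coe_rpow_of_nonneg _ hs0.le, ← enorm_eq_nnnorm] at h4
    refine h4.trans (add_le_add le_rfl ?_)
    rw [← hσ, Finset.sum_mul]
    exact Finset.sum_le_sum fun k hk => by gcongr; exact hω k hk
  calc ∑ j ∈ ρ.support, ρ j * Y.powNrm s (fun ω => b j ω)
      = ∑ j ∈ ρ.support, Y.powNrm s (fun ω => ρ j * b j ω) := by simp only [Y.powNrm_smul hs0]
    _ ≤ MY * Y.powNrm s (fun ω => ∑ j ∈ ρ.support, ρ j * (b j ω : ℝ≥0∞)) :=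
        hMY ρ.support (fun j ω => ρ j * b j ω) (fun j => by have := hbm j; fun_prop)
          fun j => by
            rw [Y.powNrm_smul hs0]
            exact ENNReal.mul_lt_top ENNReal.coe_lt_top (hbfin j)
    _ ≤ MY * (2 ^ (s - 1) * (K * (τ + MX * R) + σ' * E)) := by
        gcongr
        refine hB.trans ?_
        gcongr
        exact (hK t).trans (by gcongr)
    _ ≤ MY * (2 ^ (s - 1) * ((K * (1 + MX) + E) * (τ + R + σ'))) := by
        gcongr
        rw [add_mul]
        refine add_le_add ?_ ?_
        · rw [mul_assoc]
          gcongr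
          calc τ + MX * R ≤ (1 + MX) * τ + (1 + MX) * R :=
                add_le_add (le_mul_of_one_le_left bot_le le_self_add) (by gcongr; exact le_add_self)
            _ ≤ (1 + MX) * (τ + R + σ') := by rw [← mul_add]; exact mul_le_mul_right le_self_add _
        · rw [mul_comm]; exact mul_le_mul_right le_add_self _
    _ = _ := by
        rw [hσ]
        simp only [ENNReal.coe_mul, ENNReal.coe_add, ENNReal.coe_one, h2c]
        ring

/-- The separation step: positive functionals `φ`, `ψ` such that `φ` is dominated by the power
functional of `X`, `ψ` dominates the one of `Y`, and `ψ (|T x|^s) ≤ φ (|x|^p) + C`. The bound for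
functions `β ≤ e` makes `ψ` finite on a strictly positive function and zero on null functions. -/
theorem exists_functionals {s p : ℝ} (hs : 1 ≤ s) (hsp : s ≤ p)
    (hX : X.IsConvex p) (hY : Y.IsConcave s) {T : X.carrier →ₗ[ℝ] Y.carrier}
    (hT : IsPRegular p T) {e : Ω' → ℝ≥0} (hem : Measurable e)
    (he : Y.powNrm s (fun ω => e ω) < ∞) :
    ∃ (φ : (Ω → ℝ) →ₗ[ℝ] ℝ) (ψ : (Ω' → ℝ) →ₗ[ℝ] ℝ) (C : ℝ≥0),
      (∀ a : Ω → ℝ≥0, Measurable a → X.powNrm p (fun ω => a ω) < ∞ →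
        0 ≤ φ (fun ω => a ω) ∧ φ (fun ω => a ω) ≤ C * (X.powNrm p (fun ω => a ω)).toReal) ∧
      (∀ b : Ω' → ℝ≥0, Measurable b → (∃ (x : X.carrier) (c : ℝ≥0), ∀ ω,
          b ω ≤ c * (‖(T x : Ω' →ₘ[ν] ℝ) ω‖₊ ^ s + e ω)) →
        0 ≤ ψ (fun ω => b ω) ∧ Y.powNrm s (fun ω => b ω) ≤ ENNReal.ofReal (ψ fun ω => b ω)) ∧
      (∀ x : X.carrier, ψ (fun ω => ((‖(T x : Ω' →ₘ[ν] ℝ) ω‖₊ ^ s : ℝ≥0) : ℝ)) ≤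
        φ (fun ω => ((‖(x : Ω →ₘ[μ] ℝ) ω‖₊ ^ p : ℝ≥0) : ℝ)) + C) ∧
      (∀ β : Ω' → ℝ≥0, Measurable β → (∀ᵐ ω ∂ν, β ω ≤ e ω) → ψ (fun ω => β ω) ≤ C) := by
  have hs0 : 0 < s := by linarith
  have hp0 : 0 < p := by linarith
  obtain ⟨C, hC⟩ := exists_sum_powNrm_le_of_regular hs hsp hX hY hT he
  let IX := {a : Ω → ℝ≥0 // Measurable a ∧ X.powNrm p (fun ω => a ω) < ∞}
  let IY := {b : Ω' → ℝ≥0 // Measurable b ∧ Y.powNrm s (fun ω => b ω) < ∞}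
  let IB := {β : Ω' → ℝ≥0 // Measurable β ∧ ∀ᵐ ω ∂ν, β ω ≤ e ω}
  let xp : X.carrier → Ω → ℝ≥0 := fun x ω => ‖(x : Ω →ₘ[μ] ℝ) ω‖₊ ^ p
  let ys : X.carrier → Ω' → ℝ≥0 := fun x ω => ‖(T x : Ω' →ₘ[ν] ℝ) ω‖₊ ^ s
  -- The constraints imposed on `L (a, b) = φ a + ψ b` are indexed by the elements of `X`, `IX`, `IX`,
  -- `IY`, `IB`. Their left-hand sides are `g1`, …, `g5` and their right-hand sides `k1`, …, `k5`:
  -- `ψ (|T x|^s) - φ (|x|^p) ≤ C`, `φ a ≤ C N(a)`, `-φ a ≤ 0`, `-ψ b ≤ -N(b)`, `ψ β ≤ C`.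
  let g1 : X.carrier → (Ω → ℝ) × (Ω' → ℝ) := fun x => (-fun ω => (xp x ω : ℝ), fun ω => (ys x ω : ℝ))
  let g2 : IX → (Ω → ℝ) × (Ω' → ℝ) := fun a => (fun ω => (a.1 ω : ℝ), 0)
  let g3 : IX → (Ω → ℝ) × (Ω' → ℝ) := fun a => (-fun ω => (a.1 ω : ℝ), 0)
  let g4 : IY → (Ω → ℝ) × (Ω' → ℝ) := fun b => (0, -fun ω => (b.1 ω : ℝ))
  let g5 : IB → (Ω → ℝ) × (Ω' → ℝ) := fun β => (0, fun ω => (β.1 ω : ℝ))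
  let k1 : X.carrier → ℝ := fun _ => C
  let k2 : IX → ℝ := fun a => C * (X.powNrm p (fun ω => a.1 ω)).toReal
  let k3 : IX → ℝ := fun _ => 0
  let k4 : IY → ℝ := fun b => -(Y.powNrm s (fun ω => b.1 ω)).toReal
  let k5 : IB → ℝ := fun _ => C
  let v := (Finsupp.linearCombination ℝ≥0 g1).coprod ((Finsupp.linearCombination ℝ≥0 g2).coprod
    ((Finsupp.linearCombination ℝ≥0 g3).coprod ((Finsupp.linearCombination ℝ≥0 g4).coprod
      (Finsupp.linearCombination ℝ≥0 g5))))
  let c := (Finsupp.linearCombination ℝ≥0 k1).coprod ((Finsupp.linearCombination ℝ≥0 k2).coprod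
    ((Finsupp.linearCombination ℝ≥0 k3).coprod ((Finsupp.linearCombination ℝ≥0 k4).coprod
      (Finsupp.linearCombination ℝ≥0 k5))))
  have hv : ∀ t r q ρ σ, v (t, r, q, ρ, σ) = Finsupp.linearCombination ℝ≥0 g1 t +
      (Finsupp.linearCombination ℝ≥0 g2 r + (Finsupp.linearCombination ℝ≥0 g3 q +
        (Finsupp.linearCombination ℝ≥0 g4 ρ + Finsupp.linearCombination ℝ≥0 g5 σ))) :=
    fun t r q ρ σ => rfl
  have hc : ∀ t r q ρ σ, c (t, r, q, ρ, σ) = Finsupp.linearCombination ℝ≥0 k1 t +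
      (Finsupp.linearCombination ℝ≥0 k2 r + (Finsupp.linearCombination ℝ≥0 k3 q +
        (Finsupp.linearCombination ℝ≥0 k4 ρ + Finsupp.linearCombination ℝ≥0 k5 σ))) :=
    fun t r q ρ σ => rfl
  obtain ⟨L, hL⟩ := exists_linearMap_le v c (by
    rintro ⟨t, r, q, ρ, σ⟩ h
    rw [hv] at h
    rw [hc]
    simp only [Finsupp.linearCombination_apply, Finsupp.sum] at h ⊢
    have hX1 : ∀ ω, ∑ x ∈ t.support, t x * xp x ω ≤ ∑ i ∈ r.support, r i * i.1 ω := by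
      intro ω
      have h1 := congrFun (congrArg Prod.fst h) ω
      simp only [g1, g2, g3, g4, g5, Prod.fst_add, Prod.fst_sum, Prod.smul_fst, Prod.fst_zero,
        Pi.add_apply, Finset.sum_apply, Pi.smul_apply, Pi.neg_apply, Pi.zero_apply,
        NNReal.smul_def, smul_eq_mul, mul_neg, mul_zero, Finset.sum_neg_distrib,
        Finset.sum_const_zero, add_zero] at h1
      have h2 : (0 : ℝ) ≤ ∑ i ∈ q.support, (q i : ℝ) * i.1 ω :=
        Finset.sum_nonneg fun i _ => by positivity
      rw [← NNReal.coe_le_coe]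
      push_cast
      linarith
    have hY1 : ∀ ω, ∑ j ∈ ρ.support, ρ j * j.1 ω ≤
        ∑ x ∈ t.support, t x * ys x ω + ∑ k ∈ σ.support, σ k * k.1 ω := by
      intro ω
      have h1 := congrFun (congrArg Prod.snd h) ω
      simp only [g1, g2, g3, g4, g5, Prod.snd_add, Prod.snd_sum, Prod.smul_snd, Prod.snd_zero,
        Pi.add_apply, Finset.sum_apply, Pi.smul_apply, Pi.neg_apply, Pi.zero_apply,
        NNReal.smul_def, smul_eq_mul, mul_neg, mul_zero, Finset.sum_neg_distrib,
        Finset.sum_const_zero, zero_add] at h1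
      rw [← NNReal.coe_le_coe]
      push_cast
      linarith
    have h3 := hC (fun i : IX => i.1) (fun j : IY => j.1) (fun k : IB => k.1) t r ρ σ
      (fun i => i.2.1) (fun i => i.2.2) (fun j => j.2.1) (fun j => j.2.2) (fun k => k.2.2) hX1 hY1
    have h4 : ∑ i ∈ r.support, r i * X.powNrm p (fun ω => i.1 ω) ≠ ∞ :=
      ENNReal.sum_ne_top.2 fun i _ => ENNReal.mul_ne_top ENNReal.coe_ne_top i.2.2.ne
    have h5 := ENNReal.toReal_mono (ENNReal.mul_ne_top ENNReal.coe_ne_top (ENNReal.add_ne_top.2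
      ⟨ENNReal.add_ne_top.2 ⟨ENNReal.sum_ne_top.2 fun x _ => ENNReal.coe_ne_top, h4⟩,
        ENNReal.sum_ne_top.2 fun x _ => ENNReal.coe_ne_top⟩)) h3
    rw [ENNReal.toReal_sum fun j _ => ENNReal.mul_ne_top ENNReal.coe_ne_top j.2.2.ne,
      ENNReal.toReal_mul, ENNReal.toReal_add (ENNReal.add_ne_top.2
        ⟨ENNReal.sum_ne_top.2 fun x _ => ENNReal.coe_ne_top, h4⟩)
        (ENNReal.sum_ne_top.2 fun x _ => ENNReal.coe_ne_top),
      ENNReal.toReal_add (ENNReal.sum_ne_top.2 fun x _ => ENNReal.coe_ne_top) h4,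
      ENNReal.toReal_sum fun x _ => ENNReal.coe_ne_top,
      ENNReal.toReal_sum fun x _ => ENNReal.coe_ne_top,
      ENNReal.toReal_sum fun i _ => ENNReal.mul_ne_top ENNReal.coe_ne_top i.2.2.ne] at h5
    simp only [ENNReal.toReal_mul, ENNReal.coe_toReal, mul_add, Finset.mul_sum] at h5
    simp only [k1, k2, k3, k4, k5, NNReal.smul_def, smul_eq_mul, mul_neg, mul_zero,
      Finset.sum_neg_distrib, Finset.sum_const_zero]
    simp only [mul_comm (C : ℝ)] at h5 ⊢
    simp only [mul_assoc] at h5 ⊢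
    linarith)
  have hxp : ∀ x, Measurable (xp x) := fun x =>
    (x : Ω →ₘ[μ] ℝ).measurable.nnnorm.pow_const p
  have hys : ∀ x, Measurable (ys x) := fun x =>
    (T x : Ω' →ₘ[ν] ℝ).measurable.nnnorm.pow_const s
  have hxpfin : ∀ x, X.powNrm p (fun ω => xp x ω) < ∞ := fun x => by
    simp only [xp, ENNReal.coe_rpow_of_nonneg _ hp0.le, ← enorm_eq_nnnorm]
    rw [X.powNrm_enorm_rpow hp0]
    exact ENNReal.rpow_lt_top_of_nonneg hp0.le x.2.ne
  have hysfin : ∀ x, Y.powNrm s (fun ω => ys x ω) < ∞ := fun x => by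
    simp only [ys, ENNReal.coe_rpow_of_nonneg _ hs0.le, ← enorm_eq_nnnorm]
    rw [Y.powNrm_enorm_rpow hs0]
    exact ENNReal.rpow_lt_top_of_nonneg hs0.le (T x).2.ne
  have hdom : ∀ b : Ω' → ℝ≥0, ∀ (x : X.carrier) (c : ℝ≥0), (∀ ω, b ω ≤ c * (ys x ω + e ω)) →
      Y.powNrm s (fun ω => b ω) < ∞ := by
    intro b x c hb
    refine (Y.powNrm_mono hs0 (v := fun ω => c * (ys x ω + e ω : ℝ≥0∞))
      (Eventually.of_forall fun ω => ?_)).trans_lt ?_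
    · rw [← ENNReal.coe_add, ← ENNReal.coe_mul, ENNReal.coe_le_coe]; exact hb ω
    · rw [Y.powNrm_smul hs0]
      refine ENNReal.mul_lt_top ENNReal.coe_lt_top ((Y.powNrm_add_le hs _ _).trans_lt ?_)
      exact ENNReal.mul_lt_top (ENNReal.rpow_lt_top_of_nonneg (by linarith) (by simp))
        (ENNReal.add_lt_top.2 ⟨hysfin x, he⟩)
  let φ := L.comp (LinearMap.inl ℝ (Ω → ℝ) (Ω' → ℝ))
  let ψ := L.comp (LinearMap.inr ℝ (Ω → ℝ) (Ω' → ℝ))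
  have hφ : ∀ a, L (a, 0) = φ a := fun a => rfl
  have hψ : ∀ b, L (0, b) = ψ b := fun b => rfl
  have hsplit : ∀ a b, L (a, b) = φ a + ψ b := fun a b => by
    rw [← hφ, ← hψ, ← map_add]; simp
  refine ⟨φ, ψ, C, fun a ha hafin => ?_, ?_, fun x => ?_, fun β hβ hβe => ?_⟩
  · let i : IX := ⟨a, ha, hafin⟩
    have h1 := hL (0, Finsupp.single i 1, 0, 0, 0) (0, 0, Finsupp.single i 1, 0, 0)
      (by simp [hv, g2, g3])
    have h2 := hL (0, 0, Finsupp.single i 1, 0, 0) (0, Finsupp.single i 1, 0, 0, 0)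
      (by simp [hv, g2, g3])
    simp only [hv, hc, map_zero, zero_add, add_zero, Finsupp.linearCombination_single, one_smul,
      g2, g3, k2, k3, hsplit, map_neg, neg_nonpos] at h1 h2
    exact ⟨h2, h1⟩
  · rintro b hb ⟨x, c', hbx⟩
    have hbfin := hdom b x c' hbx
    let j : IY := ⟨b, hb, hbfin⟩
    -- the complement of `b` in its majorant
    let b' : Ω' → ℝ≥0 := fun ω => c' * (ys x ω + e ω) - b ω
    have hb' : Measurable b' := (((hys x).add hem).const_mul _).sub hb
    let j' : IY := ⟨b', hb', hdom b' x c' fun ω => tsub_le_self⟩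
    let i : IX := ⟨xp x, hxp x, hxpfin x⟩
    let k : IB := ⟨e, hem, Eventually.of_forall fun ω => le_rfl⟩
    have h1 := hL (0, 0, 0, Finsupp.single j 1, 0)
      (Finsupp.single x c', Finsupp.single i c', 0, Finsupp.single j' 1, Finsupp.single k c') (by
        simp only [hv, map_zero, zero_add, add_zero, Finsupp.linearCombination_single, one_smul,
          g1, g2, g4, g5]
        refine Prod.ext (funext fun ω => ?_) (funext fun ω => ?_)
        · simp [i]
        · have hω : b ω ≤ c' * (ys x ω + e ω) := hbx ω
          simp only [j, j', k, b', Prod.snd_add, Prod.smul_snd, Pi.add_apply, Pi.neg_apply,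
            Pi.smul_apply, NNReal.smul_def, smul_eq_mul, NNReal.coe_sub hω, Prod.snd_zero,
            Pi.zero_apply]
          push_cast
          ring)
    simp only [hv, hc, map_zero, zero_add, add_zero, Finsupp.linearCombination_single, one_smul,
      g4, k4, hsplit, map_neg, neg_le_neg_iff] at h1
    refine ⟨ENNReal.toReal_nonneg.trans h1, ?_⟩
    rw [← ENNReal.ofReal_toReal hbfin.ne]
    exact ENNReal.ofReal_le_ofReal h1
  · let i : IX := ⟨xp x, hxp x, hxpfin x⟩
    let j : IY := ⟨ys x, hys x, hysfin x⟩
    have h1 := hL (Finsupp.single x 1, 0, 0, 0, 0)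
      (0, Finsupp.single i 1, 0, Finsupp.single j 1, 0) (by simp [hv, g1, g2, g4, i, j])
    simp only [hv, hc, map_zero, add_zero, Finsupp.linearCombination_single, one_smul,
      g1, k1, hsplit, map_neg] at h1
    simp only [xp, ys] at h1
    linarith
  · have hβfin : Y.powNrm s (fun ω => β ω) < ∞ := (Y.powNrm_mono hs0 (by
      filter_upwards [hβe] with ω hω using ENNReal.coe_le_coe.2 hω)).trans_lt he
    let k : IB := ⟨β, hβ, hβe⟩
    let j : IY := ⟨β, hβ, hβfin⟩
    have h1 := hL (0, 0, 0, 0, Finsupp.single k 1) (0, 0, 0, Finsupp.single j 1, 0)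
      (by simp [hv, g4, g5, k, j])
    simpa only [hv, hc, map_zero, zero_add, add_zero, Finsupp.linearCombination_single, one_smul,
      g5, k5, hsplit] using h1

end Separation
end BanachFunctionSpace

/-! ### Countably additive weights -/

namespace BanachFunctionSpace

section Weights

variable {Ω : Type u} [MeasurableSpace Ω] {μ : Measure Ω} {Ω' : Type v} [MeasurableSpace Ω']
    {ν : Measure Ω'} {X : BanachFunctionSpace μ} {Y : BanachFunctionSpace ν}

/-- In an order continuous space the functional `φ ≤ C ‖·^(1/p)‖^p` is given by a density. -/
theorem exists_density_of_orderContinuous [SigmaFinite μ] {p : ℝ} (hp : 1 ≤ p)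
    (hX : IsOrderContinuousNorm X.fnorm) {φ : (Ω → ℝ) →ₗ[ℝ] ℝ} {C : ℝ≥0}
    (hφ : ∀ a : Ω → ℝ≥0, Measurable a → X.powNrm p (fun ω => a ω) < ∞ →
        0 ≤ φ (fun ω => a ω) ∧ φ (fun ω => a ω) ≤ C * (X.powNrm p (fun ω => a ω)).toReal) :
    ∃ h : Ω → ℝ≥0, Measurable h ∧ ∀ a : Ω → ℝ≥0, Measurable a →
      X.powNrm p (fun ω => a ω) < ∞ →
        ∫⁻ ω, a ω * h ω ∂μ = ENNReal.ofReal (φ fun ω => a ω) := by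
  have hp0 : 0 < p := by linarith
  obtain ⟨e, he, he0, hefin⟩ := X.exists_pos_nrm_lt_top
  have hepow : X.powNrm p (fun ω => ((e ω ^ p : ℝ≥0) : ℝ≥0∞)) < ∞ := by
    simp only [ENNReal.coe_rpow_of_nonneg _ hp0.le]
    rw [X.powNrm_rpow hp0]
    exact ENNReal.rpow_lt_top_of_nonneg hp0.le hefin.ne
  let D : Set (Ω → ℝ≥0) := {a | Measurable a ∧ X.powNrm p (fun ω => a ω) < ∞}
  have hDs : ∀ u ∈ D, ∀ v : Ω → ℝ≥0, Measurable v → (∀ ω, v ω ≤ u ω) → v ∈ D :=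
    fun u hu v hv hvu => ⟨hv, (X.powNrm_mono hp0 (Eventually.of_forall fun ω =>
      ENNReal.coe_le_coe.2 (hvu ω))).trans_lt hu.2⟩
  obtain ⟨h, hm, hh⟩ := exists_density_between (μ := μ) (D := D) (ψ := φ)
    (N := fun a => ENNReal.ofReal (φ fun ω => a ω)) (e := fun ω => e ω ^ p) (he.pow_const p)
    (fun ω => NNReal.rpow_pos (he0 ω)) (fun c u hu huc => ⟨hu, by
      refine (X.powNrm_mono hp0 (v := fun ω => c * ((e ω ^ p : ℝ≥0) : ℝ≥0∞))
        (Eventually.of_forall fun ω => ?_)).trans_lt ?_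
      · rw [← ENNReal.coe_mul, ENNReal.coe_le_coe]; exact huc ω
      · rw [X.powNrm_smul hp0]
        exact ENNReal.mul_lt_top ENNReal.coe_lt_top hepow⟩)
    (fun u hu => hu.1) hDs (fun u hu => (hφ u hu.1 hu.2).1)
    (fun u hu h0 => by
      refine (hφ u hu.1 hu.2).2.trans (le_of_eq ?_)
      have h1 : X.powNrm p (fun ω => (u ω : ℝ≥0∞)) = 0 := by
        rw [X.powNrm_congr hp0 (v := fun _ => 0) (by filter_upwards [h0] with ω hω; simp [hω]),
          X.powNrm_zero hp0]
      rw [h1]; simp)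
    (fun u hu => le_rfl)
    (by
      intro u U hU hu hmono hsup
      have hle : ∀ n ω, u n ω ≤ U ω := fun n ω => by
        rw [← ENNReal.coe_le_coe, ← hsup ω]; exact le_iSup (fun n => (u n ω : ℝ≥0∞)) n
      let d : ℕ → Ω → ℝ≥0 := fun n ω => U ω - u n ω
      have hd : ∀ n, d n ∈ D := fun n => hDs U hU _ (hU.1.sub (hu n).1) fun ω => tsub_le_self
      have htend : Tendsto (fun n => X.powNrm p (fun ω => d n ω)) atTop (𝓝 0) := by
        refine tendsto_powNrm_zero hp0 hX (fun n => (hd n).1.coe_nnreal_ennreal) (hd 0).2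
          (fun ω m n hmn => ENNReal.coe_le_coe.2 (tsub_le_tsub_left (hmono ω hmn) _))
          (Eventually.of_forall fun ω => ?_)
        have h1 := tendsto_atTop_iSup fun m n (hmn : m ≤ n) =>
          ENNReal.coe_le_coe.2 (hmono ω hmn)
        rw [hsup ω, ENNReal.tendsto_coe] at h1
        have h2 := (tendsto_const_nhds (x := U ω)).sub h1
        rw [tsub_self] at h2
        have h3 := ENNReal.tendsto_coe.2 h2
        rwa [ENNReal.coe_zero] at h3
      have hbound : ∀ n, ENNReal.ofReal (φ fun ω => U ω) ≤
          (⨆ n, ENNReal.ofReal (φ fun ω => u n ω)) + C * X.powNrm p (fun ω => d n ω) := by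
        intro n
        have h1 : (fun ω => (U ω : ℝ)) = (fun ω => (u n ω : ℝ)) + fun ω => (d n ω : ℝ) := by
          ext ω; simp [d, NNReal.coe_sub (hle n ω)]
        rw [h1, map_add]
        refine ENNReal.ofReal_add_le.trans (add_le_add
          (le_iSup (fun n => ENNReal.ofReal (φ fun ω => u n ω)) n) ?_)
        refine (ENNReal.ofReal_le_ofReal (hφ _ (hd n).1 (hd n).2).2).trans (le_of_eq ?_)
        rw [ENNReal.ofReal_mul C.coe_nonneg, ENNReal.ofReal_coe_nnreal,
          ENNReal.ofReal_toReal (hd n).2.ne]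
      have hlim : Tendsto (fun n => (⨆ n, ENNReal.ofReal (φ fun ω => u n ω)) +
          C * X.powNrm p (fun ω => d n ω)) atTop
          (𝓝 ((⨆ n, ENNReal.ofReal (φ fun ω => u n ω)) + C * 0)) :=
        tendsto_const_nhds.add (ENNReal.Tendsto.const_mul htend (Or.inr ENNReal.coe_ne_top))
      rw [mul_zero, add_zero] at hlim
      exact ge_of_tendsto hlim (Eventually.of_forall hbound))
  exact ⟨h, hm, fun a ha hafin => le_antisymm (hh a ⟨ha, hafin⟩).2 (hh a ⟨ha, hafin⟩).1⟩

/-- The weighted form of the factorization: `h` is the weight of the map from `X` to `L_p`, and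
`w` is the weight of the map from `L_s` to `Y`. -/
theorem exists_weights [SigmaFinite μ] [SigmaFinite ν] {s p : ℝ} (hs : 1 ≤ s) (hsp : s ≤ p)
    (hX : X.IsConvex p) (hXoc : IsOrderContinuousNorm X.fnorm) (hY : Y.IsConcave s)
    {T : X.carrier →ₗ[ℝ] Y.carrier} (hT : IsPRegular p T) :
    ∃ (h : Ω → ℝ≥0) (w : Ω' → ℝ≥0) (C : ℝ≥0), Measurable h ∧ Measurable w ∧
      (∀ᵐ ω ∂ν, 0 < w ω) ∧
      (∀ x : X.carrier, ∫⁻ ω, ‖(x : Ω →ₘ[μ] ℝ) ω‖ₑ ^ p * h ω ∂μ ≤ C * ‖x‖ₑ ^ p) ∧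
      (∀ u : Ω' → ℝ≥0∞, Measurable u → Y.powNrm s u ≤ ∫⁻ ω, u ω * w ω ∂ν) ∧
      (∀ x : X.carrier, ∫⁻ ω, ‖(T x : Ω' →ₘ[ν] ℝ) ω‖ₑ ^ s * w ω ∂ν ≤
        ∫⁻ ω, ‖(x : Ω →ₘ[μ] ℝ) ω‖ₑ ^ p * h ω ∂μ + C) := by
  have hs0 : 0 < s := by linarith
  have hp0 : 0 < p := by linarith
  obtain ⟨e₀, he₀, he₀pos, he₀fin⟩ := Y.exists_pos_nrm_lt_top
  let e : Ω' → ℝ≥0 := fun ω => e₀ ω ^ s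
  have he : Measurable e := he₀.pow_const s
  have hepos : ∀ ω, 0 < e ω := fun ω => NNReal.rpow_pos (he₀pos ω)
  have hefin : Y.powNrm s (fun ω => e ω) < ∞ := by
    simp only [e, ENNReal.coe_rpow_of_nonneg _ hs0.le]
    rw [Y.powNrm_rpow hs0]
    exact ENNReal.rpow_lt_top_of_nonneg hs0.le he₀fin.ne
  obtain ⟨φ, ψ, C, hφ, hψ, hφψ, hψe⟩ := exists_functionals hs hsp hX hY hT he hefin
  obtain ⟨h, hhm, hh⟩ := exists_density_of_orderContinuous (hs.trans hsp) hXoc hφ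
  let D : Set (Ω' → ℝ≥0) := {b | Measurable b ∧ ∃ (x : X.carrier) (c : ℝ≥0), ∀ ω,
    b ω ≤ c * (‖(T x : Ω' →ₘ[ν] ℝ) ω‖₊ ^ s + e ω)}
  have heD : ∀ (c : ℝ≥0) (u : Ω' → ℝ≥0), Measurable u → (∀ ω, u ω ≤ c * e ω) → u ∈ D :=
    fun c u hu huc => ⟨hu, 0, c, fun ω => (huc ω).trans (mul_le_mul_right le_add_self _)⟩
  obtain ⟨w, hwm, hw⟩ := exists_density_between (μ := ν) (D := D) (ψ := ψ)
    (N := fun b => Y.powNrm s fun ω => b ω) he hepos heD (fun u hu => hu.1)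
    (fun u hu v hv hvu => ⟨hv, hu.2.imp fun x => Exists.imp fun c hc ω => (hvu ω).trans (hc ω)⟩)
    (fun u hu => (hψ u hu.1 hu.2).1)
    (fun u hu h0 => by
      -- all multiples of a null function lie below `e`, where `ψ` is bounded
      have h1 : ∀ n : ℕ, n * ψ (fun ω => u ω) ≤ C := fun n => by
        have h2 := hψe (fun ω => n * u ω) (hu.1.const_mul _) (by
          filter_upwards [h0] with ω hω; simp [hω])
        have h3 : (fun ω => ((n * u ω : ℝ≥0) : ℝ)) = (n : ℝ) • fun ω => (u ω : ℝ) := by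
          ext ω; simp
        rwa [h3, map_smul, smul_eq_mul] at h2
      by_contra hpos
      obtain ⟨n, hn⟩ := Archimedean.arch (C + 1 : ℝ) (not_le.1 hpos)
      rw [nsmul_eq_mul] at hn
      linarith [h1 n])
    (fun u hu => (hψ u hu.1 hu.2).2)
    (fun u U hU hu hmono hsup => by
      simp only [← hsup]
      exact IsConcave.powNrm_iSup_le hs hY (fun n => (hu n).1.coe_nnreal_ennreal)
        fun ω m n hmn => ENNReal.coe_le_coe.2 (hmono ω hmn))
  have hlow : ∀ u : Ω' → ℝ≥0∞, Measurable u → Y.powNrm s u ≤ ∫⁻ ω, u ω * w ω ∂ν := by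
    intro u hu
    let g : ℕ → Ω' → ℝ≥0 := fun n ω => (min (u ω) (n * e ω)).toNNReal
    have hg : ∀ n ω, (g n ω : ℝ≥0∞) = min (u ω) (n * e ω) := fun n ω =>
      ENNReal.coe_toNNReal (ne_top_of_le_ne_top
        (ENNReal.mul_ne_top (ENNReal.natCast_ne_top n) ENNReal.coe_ne_top) (min_le_right _ _))
    have hgm : ∀ n, Measurable (g n) := fun n =>
      (hu.min (he.coe_nnreal_ennreal.const_mul _)).ennreal_toNNReal
    have hgD : ∀ n, g n ∈ D := fun n => heD n _ (hgm n) fun ω => by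
      rw [← ENNReal.coe_le_coe, hg]; push_cast; exact min_le_right _ _
    have hgmono : ∀ ω, Monotone fun n => (g n ω : ℝ≥0∞) := fun ω i j hij => by
      simp only [hg]
      exact min_le_min le_rfl (mul_le_mul_left (Nat.cast_le.2 hij) _)
    have hgsup : ∀ ω, ⨆ n, (g n ω : ℝ≥0∞) = u ω := fun ω => by
      refine le_antisymm (iSup_le fun n => (hg n ω).trans_le (min_le_left _ _)) ?_
      refine le_of_forall_lt fun c hc => ?_
      obtain ⟨n, hn⟩ := ENNReal.exists_nat_mul_gt (a := (e ω : ℝ≥0∞)) (b := c)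
        (by exact_mod_cast (hepos ω).ne') hc.ne_top
      refine lt_of_lt_of_le ?_ (le_iSup (fun n => (g n ω : ℝ≥0∞)) n)
      rw [hg]; exact lt_min hc hn
    calc Y.powNrm s u = Y.powNrm s (fun ω => ⨆ n, (g n ω : ℝ≥0∞)) := by simp only [hgsup]
      _ ≤ ⨆ n, Y.powNrm s (fun ω => g n ω) :=
          IsConcave.powNrm_iSup_le hs hY (fun n => (hgm n).coe_nnreal_ennreal) hgmono
      _ ≤ ∫⁻ ω, u ω * w ω ∂ν := iSup_le fun n => ((hw _ (hgD n)).1).trans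
          (lintegral_mono fun ω => mul_le_mul_left ((hg n ω).trans_le (min_le_left _ _)) _)
  have hxpfin : ∀ x : X.carrier,
      X.powNrm p (fun ω => ((‖(x : Ω →ₘ[μ] ℝ) ω‖₊ ^ p : ℝ≥0) : ℝ≥0∞)) = ‖x‖ₑ ^ p := fun x => by
    simp only [ENNReal.coe_rpow_of_nonneg _ hp0.le, ← enorm_eq_nnnorm]
    rw [X.powNrm_enorm_rpow hp0, X.fnorm_eq_enorm]
  have hφint : ∀ x : X.carrier, ∫⁻ ω, ‖(x : Ω →ₘ[μ] ℝ) ω‖ₑ ^ p * h ω ∂μ =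
      ENNReal.ofReal (φ fun ω => ((‖(x : Ω →ₘ[μ] ℝ) ω‖₊ ^ p : ℝ≥0) : ℝ)) := fun x => by
    rw [← hh _ ((x : Ω →ₘ[μ] ℝ).measurable.nnnorm.pow_const p) (by
      rw [hxpfin]; exact ENNReal.rpow_lt_top_of_nonneg hp0.le enorm_ne_top)]
    simp only [ENNReal.coe_rpow_of_nonneg _ hp0.le, ← enorm_eq_nnnorm]
  refine ⟨h, w, C, hhm, hwm, ?_, fun x => ?_, hlow, fun x => ?_⟩
  · have hS : MeasurableSet {ω | w ω = 0} := hwm (measurableSet_singleton 0)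
    have h1 : Y.powNrm s ({ω | w ω = 0}.indicator 1) = 0 := by
      refine le_antisymm ((hlow _ (measurable_one.indicator hS)).trans (le_of_eq ?_)) bot_le
      rw [lintegral_eq_zero_of_ae_eq_zero]
      refine Eventually.of_forall fun ω => ?_
      by_cases hω : w ω = 0 <;> simp [hω]
    filter_upwards [Y.ae_eq_zero_of_powNrm_eq_zero hs0 (measurable_one.indicator hS) h1] with ω hω
    refine pos_iff_ne_zero.2 fun h0 => ?_
    simp [h0] at hω
  · rw [hφint]
    have h1 := hφ _ ((x : Ω →ₘ[μ] ℝ).measurable.nnnorm.pow_const p) (by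
      rw [hxpfin]; exact ENNReal.rpow_lt_top_of_nonneg hp0.le enorm_ne_top)
    refine (ENNReal.ofReal_le_ofReal h1.2).trans (le_of_eq ?_)
    rw [hxpfin, ENNReal.ofReal_mul C.coe_nonneg, ENNReal.ofReal_coe_nnreal,
      ENNReal.ofReal_toReal (ENNReal.rpow_ne_top_of_nonneg hp0.le enorm_ne_top)]
  · rw [hφint]
    have h1 := (hw (fun ω => ‖(T x : Ω' →ₘ[ν] ℝ) ω‖₊ ^ s)
      ⟨(T x : Ω' →ₘ[ν] ℝ).measurable.nnnorm.pow_const s, x, 1, fun ω => by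
        rw [one_mul]; exact le_self_add⟩).2
    simp only [ENNReal.coe_rpow_of_nonneg _ hs0.le, ← enorm_eq_nnnorm] at h1
    refine h1.trans ((ENNReal.ofReal_le_ofReal (hφψ x)).trans (ENNReal.ofReal_add_le.trans ?_))
    rw [ENNReal.ofReal_coe_nnreal]

theorem lintegral_enorm_smul_rpow_mul (f : Ω →ₘ[μ] ℝ) {q : ℝ} (hq : 0 < q) (k : Ω → ℝ≥0)
    (c : ℝ≥0) : ∫⁻ ω, ‖((c : ℝ) • f) ω‖ₑ ^ q * k ω ∂μ =
      (c : ℝ≥0∞) ^ q * ∫⁻ ω, ‖f ω‖ₑ ^ q * k ω ∂μ := by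
  rw [← lintegral_const_mul' _ _ (ENNReal.rpow_ne_top_of_nonneg hq.le ENNReal.coe_ne_top)]
  refine lintegral_congr_ae ?_
  filter_upwards [AEEqFun.coeFn_smul (c : ℝ) f] with ω hω
  rw [hω, Pi.smul_apply, enorm_smul, ENNReal.mul_rpow_of_nonneg _ _ hq.le, mul_assoc,
    Real.enorm_eq_ofReal c.coe_nonneg, ENNReal.ofReal_coe_nnreal]

/-- Homogeneity turns the inhomogeneous estimate of `exists_weights` into the estimate between the
norms of `L_s` and `L_p`. -/
theorem lintegral_rpow_le_of_add {s p : ℝ} (hs : 0 < s) (hp : 0 < p)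
    {T : X.carrier →ₗ[ℝ] Y.carrier} {h : Ω → ℝ≥0} {w : Ω' → ℝ≥0} {C : ℝ≥0}
    (hfin : ∀ x : X.carrier, ∫⁻ ω, ‖(x : Ω →ₘ[μ] ℝ) ω‖ₑ ^ p * h ω ∂μ < ∞)
    (hadd : ∀ x : X.carrier, ∫⁻ ω, ‖(T x : Ω' →ₘ[ν] ℝ) ω‖ₑ ^ s * w ω ∂ν ≤
        ∫⁻ ω, ‖(x : Ω →ₘ[μ] ℝ) ω‖ₑ ^ p * h ω ∂μ + C) (x : X.carrier) :
    ∫⁻ ω, ‖(T x : Ω' →ₘ[ν] ℝ) ω‖ₑ ^ s * w ω ∂ν ≤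
      (1 + C) * (∫⁻ ω, ‖(x : Ω →ₘ[μ] ℝ) ω‖ₑ ^ p * h ω ∂μ) ^ (s / p) := by
  set A := ∫⁻ ω, ‖(x : Ω →ₘ[μ] ℝ) ω‖ₑ ^ p * h ω ∂μ with hA
  set B := ∫⁻ ω, ‖(T x : Ω' →ₘ[ν] ℝ) ω‖ₑ ^ s * w ω ∂ν with hB
  have key : ∀ c : ℝ≥0, (c : ℝ≥0∞) ^ s * B ≤ (c : ℝ≥0∞) ^ p * A + C := fun c => by
    have h1 := hadd ((c : ℝ) • x)
    rwa [map_smul, Submodule.coe_smul, Submodule.coe_smul, lintegral_enorm_smul_rpow_mul _ hs,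
      lintegral_enorm_smul_rpow_mul _ hp] at h1
  have hAfin : A ≠ ∞ := (hfin x).ne
  rcases eq_or_ne A 0 with h0 | h0
  · -- all multiples of `B` are bounded by `C`
    have hB0 : B = 0 := by
      by_contra hB0
      obtain ⟨n, hn⟩ := ENNReal.exists_nat_mul_gt (a := B) (b := C) hB0 ENNReal.coe_ne_top
      have h1 := key ((n : ℝ≥0) ^ (1 / s))
      rw [h0, mul_zero, zero_add, ENNReal.coe_rpow_of_nonneg _ (by positivity),
        ← ENNReal.rpow_mul, one_div_mul_cancel hs.ne', ENNReal.rpow_one, ENNReal.coe_natCast] at h1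
      exact h1.not_gt hn
    rw [hB0]; exact bot_le
  · set a : ℝ≥0 := A.toNNReal
    have ha : (a : ℝ≥0∞) = A := ENNReal.coe_toNNReal hAfin
    have ha0 : a ≠ 0 := fun h => h0 (by rw [← ha, h, ENNReal.coe_zero])
    -- scale `x` so that the first integral becomes `1`
    have h1 := key (a ^ (-(1 / p)))
    rw [ENNReal.coe_rpow_of_ne_zero ha0, ha, ← ENNReal.rpow_mul, ← ENNReal.rpow_mul,
      show -(1 / p) * p = -1 by field_simp, ENNReal.rpow_neg_one, ENNReal.inv_mul_cancel h0 hAfin,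
      show -(1 / p) * s = -(s / p) by ring, ENNReal.rpow_neg] at h1
    have h2 : A ^ (s / p) ≠ 0 := (ENNReal.rpow_pos (pos_iff_ne_zero.2 h0) hAfin).ne'
    have h3 : A ^ (s / p) ≠ ∞ := ENNReal.rpow_ne_top_of_nonneg (by positivity) hAfin
    calc B = A ^ (s / p) * ((A ^ (s / p))⁻¹ * B) := by
          rw [← mul_assoc, ENNReal.mul_inv_cancel h2 h3, one_mul]
      _ ≤ A ^ (s / p) * (1 + C) := mul_le_mul_right h1 _
      _ = _ := mul_comm _ _

end Weights
end BanachFunctionSpace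

/-! ### Multiplication operators and the factorization -/

theorem norm_le_of_enorm_le_mul {E F : Type*} [SeminormedAddCommGroup E] [SeminormedAddCommGroup F]
    {a : E} {b : F} {C : ℝ≥0} (h : ‖a‖ₑ ≤ C * ‖b‖ₑ) : ‖a‖ ≤ C * ‖b‖ := by
  rw [enorm_eq_nnnorm, enorm_eq_nnnorm, ← ENNReal.coe_mul, ENNReal.coe_le_coe] at h
  exact_mod_cast h

theorem enorm_le_of_rpow_le {a b : ℝ≥0∞} {C : ℝ≥0} {q : ℝ} (hq : 0 < q)
    (h : a ^ q ≤ C * b ^ q) : a ≤ ((C ^ (1 / q) : ℝ≥0) : ℝ≥0∞) * b := by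
  rw [← ENNReal.rpow_le_rpow_iff hq, ENNReal.mul_rpow_of_nonneg _ _ hq.le,
    ENNReal.coe_rpow_of_nonneg _ (by positivity), ← ENNReal.rpow_mul, one_div_mul_cancel hq.ne',
    ENNReal.rpow_one]
  exact h

section AEEqFunMul

variable {Ω : Type u} [MeasurableSpace Ω] {μ : Measure Ω}

theorem aeEqFun_mul_add (f g h : Ω →ₘ[μ] ℝ) : f * (g + h) = f * g + f * h := by
  refine AEEqFun.ext ?_
  filter_upwards [AEEqFun.coeFn_mul f (g + h), AEEqFun.coeFn_add g h,
    AEEqFun.coeFn_add (f * g) (f * h), AEEqFun.coeFn_mul f g, AEEqFun.coeFn_mul f h]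
    with ω h1 h2 h3 h4 h5
  simp only [h1, h2, h3, h4, h5, Pi.mul_apply, Pi.add_apply, mul_add]

theorem aeEqFun_mul_smul (c : ℝ) (f g : Ω →ₘ[μ] ℝ) : f * (c • g) = c • (f * g) := by
  refine AEEqFun.ext ?_
  filter_upwards [AEEqFun.coeFn_mul f (c • g), AEEqFun.coeFn_smul c g,
    AEEqFun.coeFn_smul c (f * g), AEEqFun.coeFn_mul f g] with ω h1 h2 h3 h4
  simp only [h1, h2, h3, h4, Pi.mul_apply, Pi.smul_apply, smul_eq_mul]; ring

theorem lp_enorm_rpow {q : ℝ≥0} (hq : q ≠ 0) (f : Lp ℝ q μ) :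
    ‖f‖ₑ ^ (q : ℝ) = ∫⁻ ω, ‖f ω‖ₑ ^ (q : ℝ) ∂μ := by
  rw [Lp.enorm_def, eLpNorm_nnreal_pow_eq_lintegral hq]

/-- Multiplication by `f`, as a linear map from a space of classes of functions to `L_q`. -/
noncomputable def mulToLp {E : Type*} [AddCommGroup E] [Module ℝ E] (q : ℝ≥0)
    (f : Ω →ₘ[μ] ℝ) (ι : E →ₗ[ℝ] (Ω →ₘ[μ] ℝ)) (h : ∀ x, f * ι x ∈ Lp ℝ q μ) :
    E →ₗ[ℝ] Lp ℝ q μ where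
  toFun x := ⟨f * ι x, h x⟩
  map_add' x y := Subtype.ext (by
    show f * ι (x + y) = f * ι x + f * ι y
    rw [map_add, aeEqFun_mul_add])
  map_smul' c x := Subtype.ext (by
    show f * ι (c • x) = c • (f * ι x)
    rw [map_smul, aeEqFun_mul_smul])

theorem enorm_mulToLp_rpow {E : Type*} [AddCommGroup E] [Module ℝ E] {q : ℝ≥0} (hq : q ≠ 0)
    (f : Ω →ₘ[μ] ℝ) (ι : E →ₗ[ℝ] (Ω →ₘ[μ] ℝ)) (h : ∀ x, f * ι x ∈ Lp ℝ q μ) (x : E) :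
    ‖mulToLp q f ι h x‖ₑ ^ (q : ℝ) = ∫⁻ ω, ‖ι x ω‖ₑ ^ (q : ℝ) * ‖f ω‖ₑ ^ (q : ℝ) ∂μ := by
  rw [lp_enorm_rpow hq]
  refine lintegral_congr_ae ?_
  filter_upwards [AEEqFun.coeFn_mul f (ι x)] with ω hω
  show ‖(f * ι x) ω‖ₑ ^ (q : ℝ) = _
  rw [hω, Pi.mul_apply, enorm_mul, ENNReal.mul_rpow_of_nonneg _ _ q.coe_nonneg, mul_comm]

theorem mul_mem_Lp {q : ℝ≥0} (hq : q ≠ 0) {f g : Ω →ₘ[μ] ℝ}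
    (h : ∫⁻ ω, ‖g ω‖ₑ ^ (q : ℝ) * ‖f ω‖ₑ ^ (q : ℝ) ∂μ < ∞) : f * g ∈ Lp ℝ q μ := by
  have hq0 : (0 : ℝ) < q := NNReal.coe_pos.2 (pos_iff_ne_zero.2 hq)
  rw [Lp.mem_Lp_iff_eLpNorm_lt_top, ← ENNReal.rpow_lt_top_iff_of_pos hq0,
    eLpNorm_nnreal_pow_eq_lintegral hq]
  refine lt_of_eq_of_lt (lintegral_congr_ae ?_) h
  filter_upwards [AEEqFun.coeFn_mul f g] with ω hω
  rw [hω, Pi.mul_apply, enorm_mul, ENNReal.mul_rpow_of_nonneg _ _ q.coe_nonneg, mul_comm]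

end AEEqFunMul

namespace BanachFunctionSpace

variable {Ω : Type u} [MeasurableSpace Ω] {μ : Measure Ω}

/-- Every function in `L_p` is a limit of functions `f x + k` with `x ∈ X`, where `k` is supported
on the zero set of `f`. -/
theorem exists_tendsto_mul_add [SigmaFinite μ] (X : BanachFunctionSpace μ) {p : ℝ≥0} (hp : p ≠ 0)
    (f : Ω →ₘ[μ] ℝ) (h : Lp ℝ p μ) :
    ∃ (x : ℕ → X.carrier) (k : Lp ℝ p μ), f * (k : Ω →ₘ[μ] ℝ) = 0 ∧
      Tendsto (fun n => ∫⁻ ω, ‖f ω * (x n : Ω →ₘ[μ] ℝ) ω + k ω - h ω‖ₑ ^ (p : ℝ) ∂μ)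
        atTop (𝓝 0) := by
  have hp0 : (0 : ℝ) < p := NNReal.coe_pos.2 (pos_iff_ne_zero.2 hp)
  obtain ⟨e, he, he0, hefin⟩ := X.exists_pos_nrm_lt_top
  let B : ℕ → Set Ω := fun n => {ω | |h ω| ≤ n * (|f ω| * e ω)}
  have hfm := f.measurable
  have hhm : Measurable h := (h : Ω →ₘ[μ] ℝ).measurable
  have hB : ∀ n, MeasurableSet (B n) := fun n =>
    measurableSet_le (by fun_prop) (by fun_prop)
  let ξ : ℕ → Ω → ℝ := fun n => (B n).indicator fun ω => h ω / f ω
  have hξm : ∀ n, Measurable (ξ n) := fun n => (hhm.div hfm).indicator (hB n)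
  have hξe : ∀ n ω, ‖ξ n ω‖ₑ ≤ (n : ℝ≥0) * (e ω : ℝ≥0∞) := by
    intro n ω
    rw [← ENNReal.coe_mul, enorm_eq_nnnorm, ENNReal.coe_le_coe, ← NNReal.coe_le_coe]
    push_cast
    rw [Real.norm_eq_abs]
    simp only [ξ]
    by_cases hω : ω ∈ B n
    · rw [Set.indicator_of_mem hω, abs_div]
      refine div_le_of_le_mul₀ (abs_nonneg _) (by positivity) ?_
      have h1 : |h ω| ≤ n * (|f ω| * e ω) := hω
      linarith
    · rw [Set.indicator_of_notMem hω, abs_zero]; positivity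
  let ξc : ℕ → Ω →ₘ[μ] ℝ := fun n => AEEqFun.mk (ξ n) (hξm n).aestronglyMeasurable
  have hξc : ∀ n, (ξc n : Ω → ℝ) =ᵐ[μ] ξ n := fun n => AEEqFun.coeFn_mk _ _
  have hξX : ∀ n, X.fnorm (ξc n) < ∞ := fun n => by
    rw [← X.nrm_enorm]
    refine (X.nrm_mono (v := fun ω => (n : ℝ≥0) * (e ω : ℝ≥0∞)) ?_).trans_lt ?_
    · filter_upwards [hξc n] with ω hω
      rw [hω]; exact hξe n ω
    · rw [X.nrm_smul]
      exact ENNReal.mul_lt_top ENNReal.coe_lt_top hefin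
  let Z : Set Ω := {ω | f ω = 0}
  have hZ : MeasurableSet Z := hfm (measurableSet_singleton 0)
  let k : Lp ℝ p μ := ((Lp.memLp h).indicator hZ).toLp _
  have hk : (k : Ω → ℝ) =ᵐ[μ] Z.indicator h := MemLp.coeFn_toLp _
  refine ⟨fun n => ⟨ξc n, hξX n⟩, k, ?_, ?_⟩
  · refine AEEqFun.ext ?_
    filter_upwards [AEEqFun.coeFn_mul f (k : Ω →ₘ[μ] ℝ), hk,
      AEEqFun.coeFn_zero (α := Ω) (β := ℝ) (μ := μ)] with ω h1 h2 h3
    rw [h1, h3, Pi.mul_apply, h2]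
    by_cases hω : f ω = 0
    · simp [hω]
    · rw [Set.indicator_of_notMem (show ω ∉ Z from hω)]; simp
  · -- the error is `h` on the sets `f ≠ 0`, `|h| > n |f| e`, which decrease to the empty set
    let G : ℕ → Ω → ℝ≥0∞ := fun n => (Zᶜ ∩ (B n)ᶜ).indicator fun ω => ‖h ω‖ₑ ^ (p : ℝ)
    have hG : ∀ n, ∫⁻ ω, ‖f ω * ξc n ω + k ω - h ω‖ₑ ^ (p : ℝ) ∂μ = ∫⁻ ω, G n ω ∂μ := fun n => by
      refine lintegral_congr_ae ?_
      filter_upwards [hξc n, hk] with ω h1 h2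
      rw [h1, h2]
      by_cases hω : f ω = 0
      · rw [hω, Set.indicator_of_mem (show ω ∈ Z from hω)]
        simp [G, show ω ∈ Z from hω, hp0]
      · by_cases hω' : ω ∈ B n
        · have h3 : f ω * (h ω / f ω) = h ω := mul_div_cancel₀ _ hω
          simp [G, ξ, show ω ∉ Z from hω, hω', h3, hp0]
        · simp [G, ξ, show ω ∉ Z from hω, hω']
    have hfin : ∫⁻ ω, ‖h ω‖ₑ ^ (p : ℝ) ∂μ ≠ ∞ := by
      rw [← lp_enorm_rpow hp]
      exact ENNReal.rpow_ne_top_of_nonneg hp0.le enorm_ne_top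
    have hlim := tendsto_lintegral_of_dominated_convergence (μ := μ) (F := G) (f := fun _ => 0)
      (fun ω => ‖h ω‖ₑ ^ (p : ℝ))
      (fun n => (hhm.enorm.pow_const _).indicator (hZ.compl.inter (hB n).compl))
      (fun n => Eventually.of_forall fun ω => Set.indicator_le_self' (fun _ _ => bot_le) ω) hfin
      (Eventually.of_forall fun ω => by
        refine tendsto_const_nhds.congr' ?_
        by_cases hω : f ω = 0
        · exact Eventually.of_forall fun n => by simp [G, show ω ∈ Z from hω]
        · have hpos : 0 < |f ω| * e ω := mul_pos (abs_pos.2 hω) (he0 ω)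
          obtain ⟨N, hN⟩ := Archimedean.arch |h ω| hpos
          filter_upwards [eventually_ge_atTop N] with n hn
          have hmem : ω ∈ B n := by
            rw [nsmul_eq_mul] at hN
            exact hN.trans (mul_le_mul_of_nonneg_right (by exact_mod_cast hn) hpos.le)
          simp [G, hmem])
    rw [lintegral_zero] at hlim
    exact hlim.congr fun n => (hG n).symm

/-- A linear map that is bounded for the norm of `f x` in `L_p` factors through `L_p`: it is
extended by continuity, and by zero to the functions supported on the zero set of `f`. -/
theorem exists_factor_through_mul [SigmaFinite μ] (X : BanachFunctionSpace μ) {p : ℝ≥0}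
    [Fact (1 ≤ (p : ℝ≥0∞))] (hp : p ≠ 0) {F : Type*} [NormedAddCommGroup F] [NormedSpace ℝ F]
    [CompleteSpace F] (f : Ω →ₘ[μ] ℝ) (Mf : X.carrier →ₗ[ℝ] Lp ℝ p μ)
    (hMf : ∀ x, (Mf x : Ω →ₘ[μ] ℝ) = f * (x : Ω →ₘ[μ] ℝ)) (S : X.carrier →ₗ[ℝ] F) {C : ℝ≥0}
    (hS : ∀ x, ‖S x‖ ≤ C * ‖Mf x‖) :
    ∃ A : Lp ℝ p μ →L[ℝ] F, ∀ x, S x = A (Mf x) := by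
  have hp0 : (0 : ℝ) < p := NNReal.coe_pos.2 (pos_iff_ne_zero.2 hp)
  let N : Submodule ℝ (Lp ℝ p μ) :=
    { carrier := {k | f * (k : Ω →ₘ[μ] ℝ) = 0}
      zero_mem' := by
        show f * 0 = 0
        have := aeEqFun_mul_smul 0 f 0
        rwa [zero_smul, zero_smul] at this
      add_mem' := fun {a b} ha hb => by
        show f * ((a : Ω →ₘ[μ] ℝ) + b) = 0
        rw [aeEqFun_mul_add, show f * (a : Ω →ₘ[μ] ℝ) = 0 from ha,
          show f * (b : Ω →ₘ[μ] ℝ) = 0 from hb, add_zero]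
      smul_mem' := fun c a ha => by
        show f * (c • (a : Ω →ₘ[μ] ℝ)) = 0
        rw [aeEqFun_mul_smul, show f * (a : Ω →ₘ[μ] ℝ) = 0 from ha, smul_zero] }
  let e : X.carrier × N →ₗ[ℝ] Lp ℝ p μ := Mf.coprod N.subtype
  let S' : X.carrier × N →ₗ[ℝ] F := S.comp (LinearMap.fst ℝ X.carrier N)
  have hle : ∀ z : X.carrier × N, ‖S' z‖ ≤ C * ‖e z‖ := by
    rintro ⟨x, k, hk⟩
    refine (hS x).trans (mul_le_mul_of_nonneg_left ?_ C.coe_nonneg)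
    refine Lp.norm_le_norm_of_ae_le ?_
    have hk' : f * (k : Ω →ₘ[μ] ℝ) = 0 := hk
    filter_upwards [AEEqFun.coeFn_mul f (k : Ω →ₘ[μ] ℝ), AEEqFun.coeFn_mul f (x : Ω →ₘ[μ] ℝ),
      Lp.coeFn_add (Mf x) k,
      AEEqFun.coeFn_zero (α := Ω) (β := ℝ) (μ := μ)] with ω h1 h2 h3 h4
    show ‖(Mf x) ω‖ ≤ ‖(Mf x + k) ω‖
    rw [hk', h4] at h1
    rw [h3, Pi.add_apply, hMf, h2, Pi.mul_apply]
    rcases mul_eq_zero.1 h1.symm with h0 | h0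
    · rw [h0, zero_mul, norm_zero]; exact norm_nonneg _
    · rw [h0, add_zero]
  have hdense : DenseRange e := by
    intro h
    obtain ⟨x, k, hk, hlim⟩ := X.exists_tendsto_mul_add hp f h
    refine mem_closure_of_tendsto (f := fun n => e (x n, ⟨k, hk⟩)) (b := atTop) ?_
      (Eventually.of_forall fun n => ⟨_, rfl⟩)
    rw [tendsto_iff_edist_tendsto_0]
    have h1 := ((ENNReal.continuous_rpow_const (y := 1 / (p : ℝ))).tendsto 0).comp hlim
    rw [ENNReal.zero_rpow_of_pos (by positivity)] at h1
    refine h1.congr fun n => ?_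
    have h2 : ‖e (x n, ⟨k, hk⟩) - h‖ₑ ^ (p : ℝ) =
        ∫⁻ ω, ‖f ω * (x n : Ω →ₘ[μ] ℝ) ω + k ω - h ω‖ₑ ^ (p : ℝ) ∂μ := by
      rw [lp_enorm_rpow hp]
      refine lintegral_congr_ae ?_
      filter_upwards [Lp.coeFn_sub (Mf (x n) + k) h, Lp.coeFn_add (Mf (x n)) k,
        AEEqFun.coeFn_mul f (x n : Ω →ₘ[μ] ℝ)] with ω h3 h4 h5
      show ‖(Mf (x n) + k - h) ω‖ₑ ^ (p : ℝ) = _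
      rw [h3, Pi.sub_apply, h4, Pi.add_apply, hMf, h5, Pi.mul_apply]
    rw [Function.comp_apply, ← h2, ← ENNReal.rpow_mul, mul_one_div_cancel hp0.ne',
      ENNReal.rpow_one, edist_eq_enorm_sub]
  refine ⟨S'.extendOfNorm e, fun x => ?_⟩
  have h1 := LinearMap.extendOfNorm_eq hdense ⟨C, hle⟩ (x, 0)
  have h2 : e (x, 0) = Mf x := by simp [e]
  rw [h2] at h1
  exact h1.symm

end BanachFunctionSpace

theorem mainTheorem2 {Ω : Type u} [MeasurableSpace Ω] {μ : Measure Ω} [SigmaFinite μ]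
    {Ω' : Type v} [MeasurableSpace Ω'] {ν : Measure Ω'} [SigmaFinite ν]
    (s p : ℝ≥0) [Fact (1 ≤ (s : ℝ≥0∞))] [Fact (1 ≤ (p : ℝ≥0∞))] (hsp : s ≤ p)
    (X : BanachFunctionSpace μ) (hX : X.IsConvex p) (hXoc : IsOrderContinuousNorm X.fnorm)
    (Y : BanachFunctionSpace ν) (hY : Y.IsConcave s) (hYoc : IsOrderContinuousNorm Y.dualNorm)
    (T : X.carrier →ₗ[ℝ] Y.carrier) (hT : IsPRegular p T) :
    ∃ (f : Ω →ₘ[μ] ℝ) (g : Ω' →ₘ[ν] ℝ)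
      (Mf : X.carrier →L[ℝ] Lp ℝ p μ) (That : Lp ℝ p μ →L[ℝ] Lp ℝ s ν)
      (Mg : Lp ℝ s ν →L[ℝ] Y.carrier),
      (∀ x, (Mf x : Ω →ₘ[μ] ℝ) = f * (x : Ω →ₘ[μ] ℝ)) ∧
      (∀ h, (Mg h : Ω' →ₘ[ν] ℝ) = g * (h : Ω' →ₘ[ν] ℝ)) ∧
      ∀ x, T x = Mg (That (Mf x)) := by
  have hs1 : (1 : ℝ) ≤ s := by
    have : (1 : ℝ≥0∞) ≤ s := Fact.out
    exact_mod_cast this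
  have hsp' : (s : ℝ) ≤ p := NNReal.coe_le_coe.2 hsp
  have hs0 : (0 : ℝ) < s := by linarith
  have hp0 : (0 : ℝ) < p := by linarith
  have hsne : s ≠ 0 := (NNReal.coe_pos.1 hs0).ne'
  have hpne : p ≠ 0 := (NNReal.coe_pos.1 hp0).ne'
  obtain ⟨h, w, C, hhm, hwm, hwpos, hxh, hlow, hadd⟩ :=
    BanachFunctionSpace.exists_weights hs1 hsp' hX hXoc hY hT
  have hxfin : ∀ x : X.carrier, ∫⁻ ω, ‖(x : Ω →ₘ[μ] ℝ) ω‖ₑ ^ (p : ℝ) * h ω ∂μ < ∞ := fun x =>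
    (hxh x).trans_lt (ENNReal.mul_lt_top ENNReal.coe_lt_top
      (ENNReal.rpow_lt_top_of_nonneg hp0.le enorm_ne_top))
  have hbound := BanachFunctionSpace.lintegral_rpow_le_of_add hs0 hp0 hxfin hadd
  let f : Ω →ₘ[μ] ℝ := AEEqFun.mk (fun ω => ((h ω ^ (1 / (p : ℝ)) : ℝ≥0) : ℝ))
    (hhm.pow_const _).coe_nnreal_real.aestronglyMeasurable
  let k : Ω' →ₘ[ν] ℝ := AEEqFun.mk (fun ω => ((w ω ^ (1 / (s : ℝ)) : ℝ≥0) : ℝ))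
    (hwm.pow_const _).coe_nnreal_real.aestronglyMeasurable
  have hf : ∀ᵐ ω ∂μ, ‖f ω‖ₑ ^ (p : ℝ) = h ω := by
    filter_upwards [AEEqFun.coeFn_mk (μ := μ) (fun ω => ((h ω ^ (1 / (p : ℝ)) : ℝ≥0) : ℝ))
      (hhm.pow_const _).coe_nnreal_real.aestronglyMeasurable] with ω hω
    rw [hω, Real.enorm_eq_ofReal (NNReal.coe_nonneg _), ENNReal.ofReal_coe_nnreal,
      ← ENNReal.coe_rpow_of_nonneg _ hp0.le, ← NNReal.rpow_mul, one_div_mul_cancel hp0.ne',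
      NNReal.rpow_one]
  have hk : ∀ᵐ ω ∂ν, ‖k ω‖ₑ ^ (s : ℝ) = w ω := by
    filter_upwards [AEEqFun.coeFn_mk (μ := ν) (fun ω => ((w ω ^ (1 / (s : ℝ)) : ℝ≥0) : ℝ))
      (hwm.pow_const _).coe_nnreal_real.aestronglyMeasurable] with ω hω
    rw [hω, Real.enorm_eq_ofReal (NNReal.coe_nonneg _), ENNReal.ofReal_coe_nnreal,
      ← ENNReal.coe_rpow_of_nonneg _ hs0.le, ← NNReal.rpow_mul, one_div_mul_cancel hs0.ne',
      NNReal.rpow_one]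
  have hk0 : ∀ᵐ ω ∂ν, k ω ≠ 0 := by
    filter_upwards [hk, hwpos] with ω h1 h2 h0
    rw [h0, enorm_zero, ENNReal.zero_rpow_of_pos hs0] at h1
    exact h2.ne (by exact_mod_cast h1)
  have hfint : ∀ x : X.carrier, ∫⁻ ω, ‖(x : Ω →ₘ[μ] ℝ) ω‖ₑ ^ (p : ℝ) * ‖f ω‖ₑ ^ (p : ℝ) ∂μ =
      ∫⁻ ω, ‖(x : Ω →ₘ[μ] ℝ) ω‖ₑ ^ (p : ℝ) * h ω ∂μ := fun x =>
    lintegral_congr_ae (by filter_upwards [hf] with ω hω; rw [hω])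
  have hkint : ∀ y : Ω' →ₘ[ν] ℝ, ∫⁻ ω, ‖y ω‖ₑ ^ (s : ℝ) * ‖k ω‖ₑ ^ (s : ℝ) ∂ν =
      ∫⁻ ω, ‖y ω‖ₑ ^ (s : ℝ) * w ω ∂ν := fun y =>
    lintegral_congr_ae (by filter_upwards [hk] with ω hω; rw [hω])
  let Mf₀ : X.carrier →ₗ[ℝ] Lp ℝ p μ := mulToLp p f X.carrier.subtype fun x =>
    mul_mem_Lp hpne ((hfint x).trans_lt (hxfin x))
  have hMf₀ : ∀ x, ‖Mf₀ x‖ₑ ^ (p : ℝ) = ∫⁻ ω, ‖(x : Ω →ₘ[μ] ℝ) ω‖ₑ ^ (p : ℝ) * h ω ∂μ :=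
    fun x => (enorm_mulToLp_rpow hpne _ _ _ x).trans (hfint x)
  let Mf : X.carrier →L[ℝ] Lp ℝ p μ := Mf₀.mkContinuous ((C ^ (1 / (p : ℝ)) : ℝ≥0) : ℝ) fun x =>
    norm_le_of_enorm_le_mul (enorm_le_of_rpow_le hp0 ((hMf₀ x).trans_le (hxh x)))
  let S : X.carrier →ₗ[ℝ] Lp ℝ s ν := mulToLp s k (Y.carrier.subtype.comp T) fun x =>
    mul_mem_Lp hsne ((hkint _).trans_lt ((hadd x).trans_lt
      (ENNReal.add_lt_top.2 ⟨hxfin x, ENNReal.coe_lt_top⟩)))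
  have hS : ∀ x, ‖S x‖ ≤ (((1 + C) ^ (1 / (s : ℝ)) : ℝ≥0) : ℝ) * ‖Mf₀ x‖ := fun x => by
    refine norm_le_of_enorm_le_mul (enorm_le_of_rpow_le hs0 ?_)
    refine ((enorm_mulToLp_rpow hsne _ _ _ x).trans (hkint _)).trans_le
      ((hbound x).trans (le_of_eq ?_))
    rw [← hMf₀, ← ENNReal.rpow_mul, mul_div_cancel₀ _ hp0.ne']
    push_cast; rfl
  obtain ⟨That, hThat⟩ := X.exists_factor_through_mul hpne f Mf₀ (fun x => rfl) S hS
  let g : Ω' →ₘ[ν] ℝ := AEEqFun.mk (fun ω => (k ω)⁻¹) k.measurable.inv.aestronglyMeasurable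
  have hg : (g : Ω' → ℝ) =ᵐ[ν] fun ω => (k ω)⁻¹ := AEEqFun.coeFn_mk _ _
  -- multiplication by `g` maps `L_s` to `Y` since `w` dominates the power functional of `Y`
  have hMg : ∀ y : Lp ℝ s ν, Y.fnorm (g * (y : Ω' →ₘ[ν] ℝ)) ≤ ‖y‖ₑ := fun y => by
    rw [← ENNReal.rpow_le_rpow_iff hs0, ← Y.powNrm_enorm_rpow hs0, lp_enorm_rpow hsne]
    refine (hlow _ ((g * (y : Ω' →ₘ[ν] ℝ)).measurable.enorm.pow_const _)).trans (le_of_eq ?_)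
    refine lintegral_congr_ae ?_
    filter_upwards [AEEqFun.coeFn_mul g (y : Ω' →ₘ[ν] ℝ), hg, hk, hk0]
      with ω h1 h2 h3 h4
    rw [h1, Pi.mul_apply, h2, ← h3, ← ENNReal.mul_rpow_of_nonneg _ _ hs0.le,
      ← enorm_mul, mul_right_comm, inv_mul_cancel₀ h4, one_mul]
  let Mg₀ : Lp ℝ s ν →ₗ[ℝ] Y.carrier :=
    { toFun := fun y => ⟨g * (y : Ω' →ₘ[ν] ℝ), (hMg y).trans_lt enorm_lt_top⟩
      map_add' := fun y z => Subtype.ext (aeEqFun_mul_add g y z)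
      map_smul' := fun c y => Subtype.ext (aeEqFun_mul_smul c g y) }
  let Mg : Lp ℝ s ν →L[ℝ] Y.carrier := Mg₀.mkContinuous ((1 : ℝ≥0) : ℝ) fun y =>
    norm_le_of_enorm_le_mul (by
      rw [ENNReal.coe_one, one_mul, ← Y.fnorm_eq_enorm]; exact hMg y)
  refine ⟨f, g, Mf, That, Mg, fun x => rfl, fun y => rfl, fun x => ?_⟩
  have h1 : That (Mf x) = S x := (hThat x).symm
  rw [h1]
  refine Subtype.ext (AEEqFun.ext ?_)
  show (T x : Ω' →ₘ[ν] ℝ) =ᵐ[ν] (g * (k * (T x : Ω' →ₘ[ν] ℝ)) : Ω' →ₘ[ν] ℝ)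
  filter_upwards [AEEqFun.coeFn_mul g (k * (T x : Ω' →ₘ[ν] ℝ)),
    AEEqFun.coeFn_mul k (T x : Ω' →ₘ[ν] ℝ), hg, hk0] with ω h2 h3 h4 h5
  rw [h2, Pi.mul_apply, h3, Pi.mul_apply, h4, inv_mul_cancel_left₀ h5]
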